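/- **Setting.** There are $n\ge 2$ agents $1,\dots,n$ and a set $M_0$ of $m$ indivisible items $1,\dots,m$. A valuation is a function $v:M_0\to[0,\infty)$, extended additively to bundles by $v(S)=\sum_{j\in S}v(j)$. For $k\ge1$ let $\mu^k(v)=\max_{S_1\sqcup\dots\sqcup S_k=M_0}\min_{b} v(S_b)$ be the maximin share for $k$ bundles (empty bundles are allowed), and for a valuation profile $(v_1,\dots,v_n)$ put $\mu_i^k=\mu^k(v_i)$. Let $v^\ell$ be the $\ell$-th highest item value under $v$, with $v^\ell=0$ for $\ell>m$. The favorite item of $v$ in a set $S$ is the item of $S$ of highest value, ties being broken in favor of the smaller index (if $S=\emptyset$, nothing is chosen). A mechanism maps reports $\mathbf r=(r_1,\dots,r_n)$ and a prediction $\mathbf p=(p_1,\dots,p_n)$, both valuation profiles, to bundles $X_1(\mathbf r,\mathbf p),\dots,X_n(\mathbf r,\mathbf p)\subseteq M_0$. In one *round* in the order $N=(i_1,\dots,i_s)$ on a set $M$ according to a profile $\mathbf w$, the agents $i_1,\dots,i_s$ in turn remove from $M$ and receive their favorite remaining item according to their $w_i$. **The mechanism Learning-Augmented-MMS-for-$n$-Agents.**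 Start with $M=M_0$, $N=(1,\dots,n)$ and all $X_i=\emptyset$. 1. *(Allocate-Large)* While some $i\in N$ satisfies $\max_{j\in M}p_i(j)\ge \mu^n(p_i)/2$ (an empty maximum is $0$), the first such $i$ receives as $X_i$ its favorite item of $M$ according to $r_i$; this item is removed from $M$ and $i$ is removed from $N$. 2. *(Tentative allocation)* According to $\mathbf p$, run on $M$ one round in the order $N$ and then rounds $2,\dots,\lceil |M|/|N|\rceil$ in the reversed order of $N$. Let $A_i$ be the set of items that $i\in N$ receives here; these are tentative bundles. 3. *(Split-Plant-Steal-Recurse)* For an ordered set $N=(i_1,\dots,i_s)$ of agents with tentative bundles $A_i$: if $s=0$, stop; if $s=1$, add $A_{i_1}$ to $X_{i_1}$ and stop. Otherwise let $N_0=(i_1,i_3,\dots)$ and $N_1=(i_2,i_4,\dots)$. *Plant:* for $t=1,\dots,\lfloor s/2\rfloor$, the $t$-th agents $a$ of $N_0$ and $b$ of $N_1$ exchange their favorite items, according to $p_a$ and $p_b$, of $A_a$ and $A_b$; if $s$ is odd, the favorite item of $A_{i_s}$ according to $p_{i_s}$ is then moved to $A_{i_2}$. *Steal:* for $b\in\{0,1\}$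 run one round according to $\mathbf r$ in the order $N_b$ on the set $\bigcup_{i\in N_{1-b}}A_i$; each received item is added to the receiver's $X_i$ and deleted from the tentative bundles. At the first level of the recursion only, the orders of $N_0$ and $N_1$ are then reversed. Recurse on $N_0$ and on $N_1$ with the current tentative bundles. **Theorem.** Let $n\ge2$, $m\ge 0$, $k=\lceil 3n/2\rceil$, $\alpha=m-\lceil 3n/2\rceil-1$. For all reports and predictions the bundles $X_1,\dots,X_n$ are pairwise disjoint, and they cover $M_0$ whenever some agent is left after step 1. Moreover: * (truthfulness) for every agent $i$, valuation $v_i$, report profile $\mathbf r$ and prediction $\mathbf p$, $v_i(X_i(v_i,\mathbf r_{-i},\mathbf p))\ge v_i(X_i(\mathbf r,\mathbf p))$; * ($2$-consistency) for every valuation profile $\mathbf v$ and every agent $i$, $v_i(X_i(\mathbf v,\mathbf v))\ge \mu_i^n/2$; * (robustness) if $\alpha>1$, then for every valuation profile $\mathbf v$, every prediction $\mathbf p$ and every agent $i$, $v_i(X_i(\mathbf v,\mathbf p))\ge \mu_i^{\lceil 3n/2\rceil}/\alpha$; * for every valuation profile $\mathbf v$, every prediction $\mathbf p$ and every agent $i$,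 $v_i(X_i(\mathbf v,\mathbf p))\ge v_i^{\lceil 3n/2\rceil}$, and if $\lceil 3n/2\rceil\le m$ then $X_i(\mathbf v,\mathbf p)$ contains an item of value at least $v_i^{\lceil 3n/2\rceil}$ for $i$. -/

import Mathlib

open scoped NNReal

noncomputable section

namespace PlantSteal

/-! ### Valuations, maximin shares, allocations -/

/-- An additive valuation of `m` goods, given by the values of the single items. -/
abbrev Valuation (m : ℕ) := Fin m → ℝ≥0

/-- The value of a bundle. -/
def value {m : ℕ} (v : Valuation m) (S : Finset (Fin m)) : ℝ≥0 := ∑ j ∈ S, v j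

/-- One valuation for each of `n` agents. -/
abbrev Profile (n m : ℕ) := Fin n → Valuation m

/-- One bundle for each of `n` agents. -/
abbrev Allocation (n m : ℕ) := Fin n → Finset (Fin m)

/-- The maximin share `μ^k` of a valuation: the best, over all partitions of the items into `k`
(possibly empty) bundles, of the value of the worst bundle. A partition is given by the map
sending an item to the index of its bundle. -/
def mms {m : ℕ} (v : Valuation m) (k : ℕ) : ℝ≥0 :=
  ⨆ f : Fin m → Fin k, ⨅ b : Fin k, value v (Finset.univ.filter fun j => f j = b)

/-- The `l`-th highest item value (`l = 1` is the highest); it is `0` for `l > m`. -/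
def kthHighest {m : ℕ} (v : Valuation m) (l : ℕ) : ℝ≥0 :=
  ((Finset.univ.val.map v).sort (· ≥ ·)).getD (l - 1) 0

/-- `X` is a `(γ, k)`-approximate MMS allocation for the valuation profile `v`. -/
def IsApproxMMS {n m : ℕ} (v : Profile n m) (X : Allocation n m) (γ : ℝ) (k : ℕ) : Prop :=
  ∀ i, (mms (v i) k : ℝ) / γ ≤ value (v i) (X i)

/-! ### Learning-augmented mechanisms -/

/-- Takes the reports and a prediction, returns a bundle for each agent. -/
abbrev Mechanism (n m : ℕ) (P : Type) := Profile n m → P → Allocation n m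

/-- Whatever the prediction and the reports of the others, agent `i` with valuation `u` does at
least as well by reporting `u` as by the report `r i`. -/
def Truthful {n m : ℕ} {P : Type} (X : Mechanism n m P) : Prop :=
  ∀ (i : Fin n) (u : Valuation m) (r : Profile n m) (p : P),
    value u (X r p i) ≤ value u (X (Function.update r i u) p i)

/-- `α`-consistency for the prediction function `f`. -/
def Consistent {n m : ℕ} {P : Type} (X : Mechanism n m P) (f : Profile n m → P) (α : ℝ) : Prop :=
  ∀ v : Profile n m, IsApproxMMS v (X v (f v)) α n

/-- `(β, k)`-robustness. -/
def Robust {n m : ℕ} {P : Type} (X : Mechanism n m P) (β : ℝ) (k : ℕ) : Prop :=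
  ∀ (v : Profile n m) (p : P), IsApproxMMS v (X v p) β k

/-! ### One round of Round-Robin -/

/-- The singleton of the favorite item of `v` in `S` (ties are broken in favor of the smaller
index); it is empty exactly if `S` is. -/
def favorite {m : ℕ} (v : Valuation m) (S : Finset (Fin m)) : Finset (Fin m) :=
  S.filter fun j => ∀ j' ∈ S, v j' < v j ∨ (v j' = v j ∧ j ≤ j')

/-- All items that the agents of the list `N` hold. -/
def pool {n m : ℕ} (A : Allocation n m) (N : List (Fin n)) : Finset (Fin m) :=
  N.toFinset.biUnion A

/-- `Allocate-Best`: the agents of `N`, in this order, take their favorite remaining item of `M`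
according to `v`. Agents outside `N` get nothing. -/
def allocateBest {n m : ℕ} (v : Profile n m) : List (Fin n) → Finset (Fin m) → Allocation n m
  | [], _ => fun _ => ∅
  | i :: N, M =>
      Function.update (allocateBest v N (M \ favorite (v i) M)) i (favorite (v i) M)

/-! ### Phase 1: `Allocate-Large` -/

/-- Remaining agents (in their order), remaining items, and the bundles allocated so far. -/
structure State (n m : ℕ) where
  agents : List (Fin n)
  items : Finset (Fin m)
  alloc : Allocation n m

/-- The remaining agent `i` has a remaining item of predicted value at least `μ_i^n / 2`, the
share being computed from the prediction and the full set of items. -/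
def isLarge {n m : ℕ} (p : Profile n m) (M : Finset (Fin m)) (i : Fin n) : Prop :=
  mms (p i) n / 2 ≤ M.sup (p i)

open Classical in
/-- `Allocate-Large`: while some remaining agent has a large predicted item, the first such agent
takes the remaining item that is best according to its report, and leaves. -/
def allocateLarge {n m : ℕ} (r p : Profile n m) (N : List (Fin n)) (M : Finset (Fin m))
    (X : Allocation n m) : State n m :=
  match h : N.find? (fun i => decide (isLarge p M i)) with
  | none => ⟨N, M, X⟩
  | some i =>
      allocateLarge r p (N.erase i) (M \ favorite (r i) M)
        (Function.update X i (favorite (r i) M))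
termination_by N.length
decreasing_by
  have hi := List.mem_of_find?_eq_some h
  have := List.length_pos_of_mem hi
  rw [List.length_erase_of_mem hi]
  omega

/-! ### Phase 2: `Tentative-Allocation-Round-Robin` -/

/-- `k` further rounds of Round-Robin in the order `N`, on top of the allocation `A`. -/
def moreRounds {n m : ℕ} (p : Profile n m) (N : List (Fin n)) :
    ℕ → Finset (Fin m) → Allocation n m → Allocation n m
  | 0, _, A => A
  | k + 1, M, A =>
      moreRounds p N k (M \ pool (allocateBest p N M) N) (fun i => A i ∪ allocateBest p N M i)

/-- One round in the order `N`, then rounds `2, …, ⌈|M| / |N|⌉` in the reversed order. -/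
def tentative {n m : ℕ} (p : Profile n m) (N : List (Fin n)) (M : Finset (Fin m)) :
    Allocation n m :=
  moreRounds p N.reverse (⌈(M.card : ℚ) / (N.length : ℚ)⌉₊ - 1)
    (M \ pool (allocateBest p N M) N) (allocateBest p N M)

/-! ### Phase 3: `Split-Plant-Steal-Recurse` -/

/-- The first, third, fifth, … entry of a list. -/
def oddPart {α : Type} : List α → List α
  | [] => []
  | [a] => [a]
  | a :: _ :: l => a :: oddPart l

/-- The second, fourth, sixth, … entry of a list. -/
def evenPart {α : Type} : List α → List α
  | [] => []
  | [_] => []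
  | _ :: b :: l => b :: evenPart l

theorem length_oddPart_le {α : Type} : ∀ l : List α, (oddPart l).length ≤ l.length
  | [] => by simp [oddPart]
  | [a] => by simp [oddPart]
  | a :: b :: l => by
      have := length_oddPart_le l
      simp only [oddPart, List.length_cons]
      omega

theorem length_evenPart_le {α : Type} : ∀ l : List α, (evenPart l).length ≤ l.length
  | [] => by simp [evenPart]
  | [a] => by simp [evenPart]
  | a :: b :: l => by
      have := length_evenPart_le l
      simp only [evenPart, List.length_cons]
      omega

/-- The agents `a` and `b` exchange their favorite items (according to the predictions) of their
tentative bundles. -/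
def plantPair {n m : ℕ} (p : Profile n m) (A : Allocation n m) (ab : Fin n × Fin n) :
    Allocation n m :=
  let ja := favorite (p ab.1) (A ab.1)
  let jb := favorite (p ab.2) (A ab.2)
  Function.update (Function.update A ab.1 ((A ab.1 ∪ jb) \ ja)) ab.2 ((A ab.2 ∪ ja) \ jb)

/-- The favorite item (according to the predictions) of the tentative bundle of `a` is moved to
the tentative bundle of `b`. -/
def plantOne {n m : ℕ} (p : Profile n m) (A : Allocation n m) (a b : Fin n) : Allocation n m :=
  let ja := favorite (p a) (A a)
  Function.update (Function.update A b (A b ∪ ja)) a (A a \ ja)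

/-- The planting step for the ordered set of agents `N`: the `t`-th agents of the two parts
exchange their favorite items, and if `|N|` is odd then the favorite item of the last agent of `N`
is planted in the bundle of the second agent of `N`. -/
def plant {n m : ℕ} (p : Profile n m) (N : List (Fin n)) (A : Allocation n m) : Allocation n m :=
  let B := ((oddPart N).zip (evenPart N)).foldl (plantPair p) A
  if N.length % 2 = 1 then
    match N.getLast?, N[1]? with
    | some a, some b => plantOne p B a b
    | _, _ => B
  else B

/-- The stealing step: the agents of each part, in order, take their favorite items (according to
the reports) from the pool of the tentative bundles of the other part. -/
def steal {n m : ℕ} (r : Profile n m) (N₀ N₁ : List (Fin n)) (T : Allocation n m) :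
    Allocation n m :=
  fun i => allocateBest r N₀ (pool T N₁) i ∪ allocateBest r N₁ (pool T N₀) i

/-- `Split-Plant-Steal-Recurse` for the ordered set of agents `N` with tentative bundles `A` and
final bundles `X` so far; `first` tells whether this is the first level of the recursion, after
which the order of the agents is reversed. Stolen items leave the tentative bundles. -/
def splitPlantSteal {n m : ℕ} (r p : Profile n m) (first : Bool) (N : List (Fin n))
    (A X : Allocation n m) : Allocation n m :=
  match N with
  | [] => X
  | [i] => Function.update X i (X i ∪ A i)
  | a :: b :: L =>
      let N₀ := oddPart (a :: b :: L)
      let N₁ := evenPart (a :: b :: L)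
      let T := plant p (a :: b :: L) A
      let S := steal r N₀ N₁ T
      let A' : Allocation n m := fun i => T i \ pool S (a :: b :: L)
      let X' : Allocation n m := fun i => X i ∪ S i
      let X'' := splitPlantSteal r p false (if first then N₀.reverse else N₀) A' X'
      splitPlantSteal r p false (if first then N₁.reverse else N₁) A' X''
termination_by N.length
decreasing_by
  · have := length_oddPart_le L
    split <;> simp only [oddPart, List.length_reverse, List.length_cons] <;> omega
  · have := length_evenPart_le L
    split <;> simp only [evenPart, List.length_reverse, List.length_cons] <;> omega

/-! ### The mechanism -/

/-- The state after `Allocate-Large` has been run on all agents and all items. -/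
def afterLarge {n m : ℕ} (r p : Profile n m) : State n m :=
  allocateLarge r p (List.finRange n) Finset.univ (fun _ => ∅)

/-- `Learning-Augmented-MMS-for-n-Agents`. The prediction is a valuation profile. -/
def nAgentMechanism (n m : ℕ) : Mechanism n m (Profile n m) := fun r p =>
  let s := afterLarge r p
  splitPlantSteal r p true s.agents (tentative p s.agents s.items) s.alloc

end PlantSteal

end

open scoped NNReal

namespace PlantSteal

variable {n m : ℕ}

/-! ### Favorite items -/

/-! Truthfulness: an agent's report never influences the sets it chooses from. In one round it takes
its favorite from what earlier agents left (`exists_allocateBest_update_eq_favorite`). In the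
recursion an agent of a part `P` steals only from the other part `Q`, and what is left to `P`
depends only on the reports in `Q`, so honest picks are optimal level by level
(`value_share_le_of_update`). In the phase of large items, an agent's report is used only at the
moment it is served (`allocateLarge_update`).

Consistency: if the reports equal the prediction, every agent steals back exactly the item planted
from its bundle, so the recursion returns the tentative bundles (`IsPickingSequence.share_eq`). Up
to one item, worth at most `μ/2`, nobody envies another tentative bundle (`value_tentative_le`).
Serving large items to all but the agents `N` removes at most `n - |N|` items and so leaves `|N|`
bundles of an optimal partition intact (`sub_mul_mms_le_value`). Hence `|N| μ ≤ v(M) ≤ |N| (v(A_i) +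
μ/2)`.

Robustness: let `K` be upward closed for agent `i`. If `i` steals nothing from `K` at some level, at
most `|Q|` items of `K` are stolen from its part, and those in the pool of `Q` were all taken before
its turn, so there are at most as many as its position in `P` (`card_inter_pool_le`). Positions
halve when the list is split, so the inequality `|N| + position ≤ |K ∩ pool|` is inherited
(`exists_mem_share_inter`). The reversal after the first level makes the total loss independent of
the position, and `n + ⌈n/2⌉ - 1` items in `K` suffice (`exists_mem_nAgentMechanism_inter`). Thus
`i` gets an item worth its `(k-1)`-th best. All but `k - 2` items are worth no more than that, so
two of any `k` bundles share only such items, and the smaller one bounds the maximin share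
(`mms_le_mul_of_card_add_two`). -/

/-- Under `v`, with ties broken in favor of the smaller index, `x` is strictly better than `y`. -/
def Beats (v : Valuation m) (x y : Fin m) : Prop := v y < v x ∨ (v y = v x ∧ x < y)

theorem Beats.ne {v : Valuation m} {x y : Fin m} (h : Beats v x y) : x ≠ y := by
  rintro rfl
  rcases h with h | h
  · exact lt_irrefl _ h
  · exact lt_irrefl _ h.2

theorem Beats.le {v : Valuation m} {x y : Fin m} (h : Beats v x y) : v y ≤ v x := by
  rcases h with h | h
  · exact h.le
  · exact h.1.le

theorem favorite_subset (v : Valuation m) (S : Finset (Fin m)) : favorite v S ⊆ S :=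
  Finset.filter_subset _ _

@[simp] theorem favorite_empty (v : Valuation m) : favorite v ∅ = ∅ := by
  simp [favorite]

theorem favorite_eq_singleton {v : Valuation m} {S : Finset (Fin m)} {x : Fin m} (hx : x ∈ S)
    (h : ∀ y ∈ S, y ≠ x → Beats v x y) : favorite v S = {x} := by
  ext z
  simp only [favorite, Finset.mem_filter, Finset.mem_singleton]
  constructor
  · rintro ⟨hz, hz'⟩
    by_contra hne
    rcases h z hz hne with h1 | h1 <;> rcases hz' x hx with h2 | h2
    · exact lt_asymm h1 h2
    · exact h1.ne h2.1.symm
    · exact h2.ne h1.1.symm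
    · exact absurd h1.2 (not_lt.2 h2.2)
  · rintro rfl
    refine ⟨hx, fun y hy => ?_⟩
    by_cases hyz : y = z
    · subst hyz
      exact Or.inr ⟨rfl, le_rfl⟩
    · rcases h y hy hyz with h1 | h1
      · exact Or.inl h1
      · exact Or.inr ⟨h1.1, h1.2.le⟩

theorem exists_favorite (v : Valuation m) {S : Finset (Fin m)} (hS : S.Nonempty) :
    ∃ x ∈ S, favorite v S = {x} ∧ ∀ y ∈ S, y ≠ x → Beats v x y := by
  obtain ⟨x, hx, hmax⟩ := S.exists_max_image v hS
  obtain ⟨z, hz, hmin⟩ := (S.filter fun y => v y = v x).exists_min_image id ⟨x, by simp [hx]⟩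
  simp only [Finset.mem_filter, id, and_imp] at hz hmin
  have key : ∀ y ∈ S, y ≠ z → Beats v z y := by
    intro y hy hyz
    rcases (hmax y hy).lt_or_eq with h | h
    · exact Or.inl (hz.2 ▸ h)
    · exact Or.inr ⟨h.trans hz.2.symm, lt_of_le_of_ne (hmin y hy h) (Ne.symm hyz)⟩
  exact ⟨z, hz.1, favorite_eq_singleton hz.1 key, key⟩

theorem favorite_eq_empty_iff {v : Valuation m} {S : Finset (Fin m)} :
    favorite v S = ∅ ↔ S = ∅ := by
  constructor
  · intro h
    by_contra hS
    obtain ⟨x, -, hx, -⟩ := exists_favorite v (Finset.nonempty_iff_ne_empty.2 hS)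
    simp [h] at hx
  · rintro rfl
    simp

theorem card_favorite_le_one (v : Valuation m) (S : Finset (Fin m)) :
    (favorite v S).card ≤ 1 := by
  rcases S.eq_empty_or_nonempty with rfl | hS
  · simp
  · obtain ⟨x, -, hx, -⟩ := exists_favorite v hS
    simp [hx]

theorem beats_of_mem_favorite {v : Valuation m} {S : Finset (Fin m)} {x y : Fin m}
    (hx : x ∈ favorite v S) (hy : y ∈ S) (hne : y ≠ x) : Beats v x y := by
  obtain ⟨z, -, hz, h⟩ := exists_favorite v ⟨y, hy⟩
  rw [hz, Finset.mem_singleton] at hx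
  subst hx
  exact h y hy hne

theorem le_of_mem_favorite {v : Valuation m} {S : Finset (Fin m)} {x y : Fin m}
    (hx : x ∈ favorite v S) (hy : y ∈ S) : v y ≤ v x := by
  by_cases h : y = x
  · rw [h]
  · exact (beats_of_mem_favorite hx hy h).le

theorem sup_le_value_favorite (v : Valuation m) (S : Finset (Fin m)) :
    S.sup v ≤ value v (favorite v S) := by
  refine Finset.sup_le fun y hy => ?_
  obtain ⟨x, -, hx, h⟩ := exists_favorite v ⟨y, hy⟩
  have := le_of_mem_favorite (v := v) (S := S) (x := x) (by simp [hx]) hy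
  simpa [hx, value] using this

theorem value_favorite_le (u w : Valuation m) (S : Finset (Fin m)) :
    value u (favorite w S) ≤ value u (favorite u S) := by
  rcases S.eq_empty_or_nonempty with rfl | hS
  · simp
  · obtain ⟨x, hx, hx', -⟩ := exists_favorite w hS
    refine le_trans ?_ (sup_le_value_favorite u S)
    simpa [hx', value] using Finset.le_sup (f := u) hx

theorem value_union (v : Valuation m) {S T : Finset (Fin m)} (h : Disjoint S T) :
    value v (S ∪ T) = value v S + value v T :=
  Finset.sum_union h

theorem le_value_of_mem (v : Valuation m) {S : Finset (Fin m)} {x : Fin m} (h : x ∈ S) :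
    v x ≤ value v S :=
  Finset.single_le_sum (f := v) (fun _ _ => zero_le) h

/-! ### Pools -/

@[simp] theorem mem_pool {A : Allocation n m} {N : List (Fin n)} {x : Fin m} :
    x ∈ pool A N ↔ ∃ i ∈ N, x ∈ A i := by
  simp [pool]

theorem pool_congr {A B : Allocation n m} {N : List (Fin n)} (h : ∀ i ∈ N, A i = B i) :
    pool A N = pool B N := by
  ext x
  simp only [mem_pool]
  exact ⟨fun ⟨i, hi, hx⟩ => ⟨i, hi, h i hi ▸ hx⟩, fun ⟨i, hi, hx⟩ => ⟨i, hi, (h i hi).symm ▸ hx⟩⟩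

theorem pool_eq_of_mem_iff (A : Allocation n m) {N N' : List (Fin n)}
    (h : ∀ i, i ∈ N ↔ i ∈ N') : pool A N = pool A N' := by
  ext x
  simp [h]

/-! ### One round of picking -/

theorem allocateBest_of_notMem (v : Profile n m) {N : List (Fin n)} (M : Finset (Fin m))
    {i : Fin n} (hi : i ∉ N) : allocateBest v N M i = ∅ := by
  induction N generalizing M with
  | nil => rfl
  | cons j N ih =>
    simp only [List.mem_cons, not_or] at hi
    rw [allocateBest, Function.update_of_ne hi.1]
    exact ih _ hi.2

theorem allocateBest_subset (v : Profile n m) (N : List (Fin n)) (M : Finset (Fin m))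
    (i : Fin n) : allocateBest v N M i ⊆ M := by
  induction N generalizing M with
  | nil => exact Finset.empty_subset _
  | cons j N ih =>
    rw [allocateBest]
    by_cases h : i = j
    · subst h
      rw [Function.update_self]
      exact favorite_subset _ _
    · rw [Function.update_of_ne h]
      exact (ih _).trans Finset.sdiff_subset

theorem card_allocateBest_le_one (v : Profile n m) (N : List (Fin n)) (M : Finset (Fin m))
    (i : Fin n) : (allocateBest v N M i).card ≤ 1 := by
  induction N generalizing M with
  | nil => simp [allocateBest]
  | cons j N ih =>
    rw [allocateBest]
    by_cases h : i = j
    · subst h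
      rw [Function.update_self]
      exact card_favorite_le_one _ _
    · rw [Function.update_of_ne h]
      exact ih _

theorem disjoint_allocateBest (v : Profile n m) (N : List (Fin n)) (M : Finset (Fin m))
    {i j : Fin n} (hij : i ≠ j) : Disjoint (allocateBest v N M i) (allocateBest v N M j) := by
  induction N generalizing M with
  | nil => exact Finset.disjoint_empty_left _
  | cons a N ih =>
    have key : ∀ j, Disjoint (favorite (v a) M)
        (allocateBest v N (M \ favorite (v a) M) j) := fun j =>
      Finset.disjoint_sdiff.mono_right (allocateBest_subset v N _ j)
    rw [allocateBest]
    by_cases hi : i = a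
    · subst hi
      rw [Function.update_self, Function.update_of_ne hij.symm]
      exact key j
    · by_cases hj : j = a
      · subst hj
        rw [Function.update_self, Function.update_of_ne hi]
        exact (key i).symm
      · rw [Function.update_of_ne hi, Function.update_of_ne hj]
        exact ih _

theorem allocateBest_congr {v w : Profile n m} {N : List (Fin n)} (M : Finset (Fin m))
    (h : ∀ i ∈ N, v i = w i) : allocateBest v N M = allocateBest w N M := by
  induction N generalizing M with
  | nil => rfl
  | cons a N ih =>
    simp only [List.mem_cons, forall_eq_or_imp] at h
    rw [allocateBest, allocateBest, h.1, ih _ h.2]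

/-- `R` is what the agents before `i` leave; each takes at most one item and none looks at `u`.
Having one `R` for all `u` gives truthfulness, the bound on `M \ R` gives the counting for
robustness. -/
theorem exists_allocateBest_update_eq_favorite (v : Profile n m) {N : List (Fin n)}
    (M : Finset (Fin m)) {i : Fin n} (hi : i ∈ N) :
    ∃ R ⊆ M, (M \ R).card ≤ N.idxOf i ∧
      ∀ u, allocateBest (Function.update v i u) N M i = favorite u R := by
  induction N generalizing M with
  | nil => simp at hi
  | cons a N ih =>
    by_cases h : i = a
    · subst h
      exact ⟨M, subset_rfl, by simp, fun u => by simp [allocateBest]⟩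
    · obtain ⟨R, hR, hcard, hfav⟩ := ih (M \ favorite (v a) M)
        ((List.mem_cons.1 hi).resolve_left h)
      refine ⟨R, hR.trans Finset.sdiff_subset, ?_, fun u => ?_⟩
      · rw [List.idxOf_cons_ne _ (Ne.symm h)]
        have hsub : M \ R ⊆ ((M \ favorite (v a) M) \ R) ∪ favorite (v a) M := by
          intro x hx
          simp only [Finset.mem_sdiff, Finset.mem_union] at hx ⊢
          tauto
        have := (Finset.card_le_card hsub).trans (Finset.card_union_le _ _)
        have := card_favorite_le_one (v a) M
        omega
      · rw [allocateBest, Function.update_of_ne h, Function.update_of_ne (Ne.symm h), hfav]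

theorem exists_allocateBest_eq_favorite (v : Profile n m) {N : List (Fin n)}
    (M : Finset (Fin m)) {i : Fin n} (hi : i ∈ N) :
    ∃ R ⊆ M, (M \ R).card ≤ N.idxOf i ∧ allocateBest v N M i = favorite (v i) R := by
  obtain ⟨R, hR, hcard, h⟩ := exists_allocateBest_update_eq_favorite v M hi
  refine ⟨R, hR, hcard, ?_⟩
  simpa using h (v i)

theorem value_allocateBest_le (v : Profile n m) (N : List (Fin n)) (M : Finset (Fin m))
    (i : Fin n) (u : Valuation m) :
    value u (allocateBest v N M i) ≤ value u (allocateBest (Function.update v i u) N M i) := by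
  by_cases hi : i ∈ N
  · obtain ⟨R, -, -, h⟩ := exists_allocateBest_update_eq_favorite v M hi
    have h' := h (v i)
    rw [Function.update_eq_self] at h'
    rw [h', h u]
    exact value_favorite_le _ _ _
  · simp [allocateBest_of_notMem _ M hi]

/-- In a round with picks `R`, agent `i` strictly prefers its own pick to that of `j`, and `j` picks
nothing if `i` does. -/
def Precedes (v : Profile n m) (R : Allocation n m) (i j : Fin n) : Prop :=
  (∀ x ∈ R i, ∀ y ∈ R j, Beats (v i) x y) ∧ (R i = ∅ → R j = ∅)

theorem pairwise_precedes_allocateBest (v : Profile n m) {N : List (Fin n)} (hN : N.Nodup)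
    (M : Finset (Fin m)) : N.Pairwise (Precedes v (allocateBest v N M)) := by
  induction N generalizing M with
  | nil => exact List.Pairwise.nil
  | cons a N ih =>
    rw [List.nodup_cons] at hN
    have hne : ∀ j ∈ N, j ≠ a := fun j hj h => hN.1 (h ▸ hj)
    rw [allocateBest]
    refine List.Pairwise.cons (fun j hj => ?_) ?_
    · unfold Precedes
      rw [Function.update_self, Function.update_of_ne (hne j hj)]
      refine ⟨fun x hx y hy => ?_, fun h => ?_⟩
      · have := allocateBest_subset _ _ _ _ hy
        rw [Finset.mem_sdiff] at this
        exact beats_of_mem_favorite hx this.1 fun h => this.2 (h ▸ hx)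
      · rw [favorite_eq_empty_iff] at h
        subst h
        exact Finset.subset_empty.1 ((allocateBest_subset _ _ _ _).trans Finset.sdiff_subset)
    · refine (ih hN.2 (M \ favorite (v a) M)).imp_of_mem ?_
      intro i j hi hj h
      unfold Precedes
      rw [Function.update_of_ne (hne i hi), Function.update_of_ne (hne j hj)]
      exact h

theorem pool_allocateBest_cons (v : Profile n m) {a : Fin n} {N : List (Fin n)} (ha : a ∉ N)
    (M : Finset (Fin m)) :
    pool (allocateBest v (a :: N) M) (a :: N) =
      favorite (v a) M ∪ pool (allocateBest v N (M \ favorite (v a) M)) N := by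
  ext x
  simp only [mem_pool, List.mem_cons, exists_eq_or_imp, allocateBest, Function.update_self,
    Finset.mem_union]
  refine or_congr_right (exists_congr fun i => and_congr_right fun hi => ?_)
  rw [Function.update_of_ne (fun h : i = a => ha (h ▸ hi))]

theorem sdiff_pool_allocateBest_cons (v : Profile n m) {a : Fin n} {N : List (Fin n)}
    (ha : a ∉ N) (M : Finset (Fin m)) :
    M \ pool (allocateBest v (a :: N) M) (a :: N) =
      (M \ favorite (v a) M) \ pool (allocateBest v N (M \ favorite (v a) M)) N := by
  rw [pool_allocateBest_cons v ha, sdiff_sdiff_left, Finset.sup_eq_union]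

theorem beats_of_mem_allocateBest (v : Profile n m) {N : List (Fin n)} (hN : N.Nodup)
    (M : Finset (Fin m)) {i : Fin n} {x y : Fin m}
    (hx : x ∈ allocateBest v N M i) (hy : y ∈ M \ pool (allocateBest v N M) N) :
    Beats (v i) x y := by
  induction N generalizing M with
  | nil => simp [allocateBest] at hx
  | cons a N ih =>
    rw [List.nodup_cons] at hN
    rw [sdiff_pool_allocateBest_cons v hN.1] at hy
    rw [allocateBest] at hx
    by_cases h : i = a
    · subst h
      rw [Function.update_self] at hx
      have hy' := Finset.mem_sdiff.1 (Finset.mem_sdiff.1 hy).1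
      exact beats_of_mem_favorite hx hy'.1 fun h => hy'.2 (h ▸ hx)
    · rw [Function.update_of_ne h] at hx
      exact ih hN.2 _ hx hy

/-- A nonempty set has a favorite, so an empty pick means that the items were exhausted at that
turn. -/
theorem sdiff_pool_eq_empty_of_allocateBest_eq_empty (v : Profile n m) {N : List (Fin n)}
    (hN : N.Nodup) (M : Finset (Fin m)) {i : Fin n} (hi : i ∈ N)
    (h : allocateBest v N M i = ∅) : M \ pool (allocateBest v N M) N = ∅ := by
  induction N generalizing M with
  | nil => simp at hi
  | cons a N ih =>
    rw [List.nodup_cons] at hN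
    rw [sdiff_pool_allocateBest_cons v hN.1]
    rw [allocateBest] at h
    by_cases hia : i = a
    · subst hia
      rw [Function.update_self, favorite_eq_empty_iff] at h
      simp [h]
    · rw [Function.update_of_ne hia] at h
      exact ih hN.2 _ ((List.mem_cons.1 hi).resolve_left hia) h

theorem card_sdiff_pool_allocateBest (v : Profile n m) {N : List (Fin n)} (hN : N.Nodup)
    (M : Finset (Fin m)) :
    (M \ pool (allocateBest v N M) N).card = M.card - N.length := by
  induction N generalizing M with
  | nil => simp [pool]
  | cons a N ih =>
    rw [List.nodup_cons] at hN
    rw [sdiff_pool_allocateBest_cons v hN.1, ih hN.2, List.length_cons,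
      Finset.card_sdiff_of_subset (favorite_subset _ _)]
    rcases M.eq_empty_or_nonempty with rfl | hM
    · simp
    · obtain ⟨x, -, hx, -⟩ := exists_favorite (v a) hM
      rw [hx, Finset.card_singleton]
      omega

/-- If the order in which the agents prefer the picks `B` is that of `N`, then the round on any set
`M` whose other items are worse for all of them reproduces `B`. -/
theorem allocateBest_eq_of_pairwise_precedes (v : Profile n m) {N : List (Fin n)} (hN : N.Nodup)
    {B : Allocation n m} (hcard : ∀ i ∈ N, (B i).card ≤ 1) (hB : N.Pairwise (Precedes v B))
    {M : Finset (Fin m)} (hsub : pool B N ⊆ M)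
    (hrest : ∀ i ∈ N, ∀ x ∈ B i, ∀ y ∈ M \ pool B N, Beats (v i) x y)
    (hempty : ∀ i ∈ N, B i = ∅ → M ⊆ pool B N) :
    ∀ i ∈ N, allocateBest v N M i = B i := by
  induction N generalizing M with
  | nil => simp
  | cons a N ih =>
    rw [List.nodup_cons] at hN
    rw [List.pairwise_cons] at hB
    -- The first agent prefers its item to the later picks by `hB` and to all other items by
    -- `hrest`. If it has none, `hempty` and `hB` leave no item at all.
    have hfav : favorite (v a) M = B a := by
      rcases (B a).eq_empty_or_nonempty with h | ⟨x, hx⟩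
      · rw [h, favorite_eq_empty_iff, ← Finset.subset_empty]
        intro y hy
        obtain ⟨j, hj, hyj⟩ := mem_pool.1 (hempty a (by simp) h hy)
        rcases List.mem_cons.1 hj with rfl | hj
        · rwa [h] at hyj
        · rwa [(hB.1 j hj).2 h] at hyj
      · have hs : B a = {x} := Finset.eq_singleton_iff_unique_mem.2
          ⟨hx, fun y hy => Finset.card_le_one.1 (hcard a (by simp)) y hy x hx⟩
        rw [hs]
        refine favorite_eq_singleton (hsub (mem_pool.2 ⟨a, by simp, hx⟩)) fun y hy hne => ?_
        by_cases hyp : y ∈ pool B (a :: N)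
        · obtain ⟨j, hj, hyj⟩ := mem_pool.1 hyp
          rcases List.mem_cons.1 hj with rfl | hj
          · rw [hs, Finset.mem_singleton] at hyj
            exact absurd hyj hne
          · exact (hB.1 j hj).1 x hx y hyj
        · exact hrest a (by simp) x hx y (Finset.mem_sdiff.2 ⟨hy, hyp⟩)
    have hdisj : ∀ j ∈ N, ∀ y ∈ B j, y ∉ B a := fun j hj y hy hya =>
      ((hB.1 j hj).1 y hya y hy).ne rfl
    have hsd : ∀ y, y ∈ M \ B a → y ∉ pool B N → y ∈ M \ pool B (a :: N) := by
      intro y hy hyN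
      simp only [Finset.mem_sdiff, mem_pool, List.mem_cons, exists_eq_or_imp] at hy hyN ⊢
      exact ⟨hy.1, not_or.2 ⟨hy.2, hyN⟩⟩
    intro i hi
    rw [allocateBest, hfav]
    by_cases hia : i = a
    · subst hia
      simp
    · rw [Function.update_of_ne hia]
      refine ih hN.2 (fun i hi => hcard i (List.mem_cons_of_mem _ hi)) hB.2 ?_ ?_ ?_ i
        ((List.mem_cons.1 hi).resolve_left hia)
      · intro y hy
        obtain ⟨j, hj, hyj⟩ := mem_pool.1 hy
        exact Finset.mem_sdiff.2 ⟨hsub (mem_pool.2 ⟨j, List.mem_cons_of_mem _ hj, hyj⟩),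
          hdisj j hj y hyj⟩
      · intro i hi x hx y hy
        rw [Finset.mem_sdiff] at hy
        exact hrest i (List.mem_cons_of_mem _ hi) x hx y (hsd y hy.1 hy.2)
      · intro i hi h y hy
        by_contra hyN
        have := Finset.mem_sdiff.1 (hsd y hy hyN)
        exact this.2 (hempty i (List.mem_cons_of_mem _ hi) h this.1)

/-! ### Splitting the agents -/

theorem mem_oddPart_or_evenPart {α : Type} (i : α) :
    ∀ l : List α, i ∈ l ↔ i ∈ oddPart l ∨ i ∈ evenPart l
  | [] => by simp [oddPart, evenPart]
  | [a] => by simp [oddPart, evenPart]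
  | a :: b :: l => by
      simp only [oddPart, evenPart, List.mem_cons, mem_oddPart_or_evenPart i l]
      tauto

theorem oddPart_sublist {α : Type} : ∀ l : List α, (oddPart l).Sublist l
  | [] => .refl _
  | [_] => .refl _
  | _ :: _ :: l => ((oddPart_sublist l).cons _).cons_cons _

theorem evenPart_sublist {α : Type} : ∀ l : List α, (evenPart l).Sublist l
  | [] => .refl _
  | [_] => List.nil_sublist _
  | _ :: _ :: l => ((evenPart_sublist l).cons_cons _).cons _

theorem disjoint_oddPart_evenPart {α : Type} :
    ∀ {l : List α}, l.Nodup → ∀ i ∈ oddPart l, i ∉ evenPart l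
  | [], _ => by simp [oddPart]
  | [a], _ => by simp [evenPart]
  | a :: b :: l, h => by
      simp only [List.nodup_cons, List.mem_cons, not_or] at h
      have ih := disjoint_oddPart_evenPart h.2.2
      have ho := (oddPart_sublist l).subset
      have he := (evenPart_sublist l).subset
      intro i
      simp only [oddPart, evenPart, List.mem_cons, not_or]
      rintro (rfl | hi)
      · exact ⟨h.1.1, fun hi => h.1.2 (he hi)⟩
      · exact ⟨fun hib => h.2.1 (hib ▸ ho hi), ih i hi⟩

theorem length_oddPart {α : Type} : ∀ l : List α, (oddPart l).length = (l.length + 1) / 2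
  | [] => by simp [oddPart]
  | [a] => by simp [oddPart]
  | a :: b :: l => by
      simp only [oddPart, List.length_cons, length_oddPart l]
      omega

theorem length_evenPart {α : Type} : ∀ l : List α, (evenPart l).length = l.length / 2
  | [] => by simp [evenPart]
  | [a] => by simp [evenPart]
  | a :: b :: l => by
      simp only [evenPart, List.length_cons, length_evenPart l]
      omega

/-- Each entry of the part uses up two entries of the list. This halving keeps the invariant of
`exists_mem_share_inter` alive. -/
theorem two_mul_idxOf_oddPart_le {α : Type} [DecidableEq α] (i : α) :
    ∀ {l : List α}, l.Nodup → i ∈ oddPart l → 2 * (oddPart l).idxOf i ≤ l.idxOf i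
  | [], _, h => by simp [oddPart] at h
  | [a], _, h => by simp_all [oddPart]
  | a :: b :: l, hl, h => by
      simp only [oddPart] at h ⊢
      simp only [List.nodup_cons, List.mem_cons, not_or] at hl
      by_cases ha : a = i
      · subst ha
        simp
      · have h' := (List.mem_cons.1 h).resolve_left (Ne.symm ha)
        have ih := two_mul_idxOf_oddPart_le i hl.2.2 h'
        have hb : b ≠ i := fun hb => hl.2.1 (hb ▸ (oddPart_sublist l).subset h')
        rw [List.idxOf_cons_ne _ ha, List.idxOf_cons_ne _ ha, List.idxOf_cons_ne _ hb]
        omega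

theorem two_mul_idxOf_evenPart_le {α : Type} [DecidableEq α] (i : α) :
    ∀ {l : List α}, l.Nodup → i ∈ evenPart l → 2 * (evenPart l).idxOf i ≤ l.idxOf i
  | [], _, h => by simp [evenPart] at h
  | [a], _, h => by simp [evenPart] at h
  | a :: b :: l, hl, h => by
      simp only [evenPart] at h ⊢
      simp only [List.nodup_cons, List.mem_cons, not_or] at hl
      by_cases hb : b = i
      · subst hb
        simp
      · have h' := (List.mem_cons.1 h).resolve_left (Ne.symm hb)
        have ih := two_mul_idxOf_evenPart_le i hl.2.2 h'
        have ha : a ≠ i := fun ha => hl.1.2 (ha ▸ (evenPart_sublist l).subset h')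
        rw [List.idxOf_cons_ne _ hb, List.idxOf_cons_ne _ ha, List.idxOf_cons_ne _ hb]
        omega

/-- `P` and `Q` are the two parts, in any order, into which the list `N` is split. -/
def IsSplit {α : Type} (N P Q : List α) : Prop :=
  (P = oddPart N ∧ Q = evenPart N) ∨ (P = evenPart N ∧ Q = oddPart N)

namespace IsSplit

variable {α : Type} {N P Q : List α}

theorem symm (h : IsSplit N P Q) : IsSplit N Q P := by
  rcases h with h | h
  · exact Or.inr ⟨h.2, h.1⟩
  · exact Or.inl ⟨h.2, h.1⟩

theorem mem_iff (h : IsSplit N P Q) (i : α) : i ∈ N ↔ i ∈ P ∨ i ∈ Q := by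
  rcases h with ⟨rfl, rfl⟩ | ⟨rfl, rfl⟩
  · exact mem_oddPart_or_evenPart i N
  · rw [or_comm]
    exact mem_oddPart_or_evenPart i N

theorem sublist (h : IsSplit N P Q) : P.Sublist N := by
  rcases h with ⟨rfl, rfl⟩ | ⟨rfl, rfl⟩
  · exact oddPart_sublist N
  · exact evenPart_sublist N

theorem notMem (h : IsSplit N P Q) (hN : N.Nodup) {i : α} (hi : i ∈ P) : i ∉ Q := by
  rcases h with ⟨rfl, rfl⟩ | ⟨rfl, rfl⟩
  · exact disjoint_oddPart_evenPart hN i hi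
  · exact fun hi' => disjoint_oddPart_evenPart hN i hi' hi

theorem length_add (h : IsSplit N P Q) : P.length + Q.length = N.length := by
  rcases h with ⟨rfl, rfl⟩ | ⟨rfl, rfl⟩ <;> rw [length_oddPart, length_evenPart] <;> omega

theorem length_le (h : IsSplit N P Q) : P.length ≤ (N.length + 1) / 2 := by
  rcases h with ⟨rfl, rfl⟩ | ⟨rfl, rfl⟩
  · rw [length_oddPart]
  · rw [length_evenPart]
    omega

theorem two_mul_idxOf_le [DecidableEq α] (h : IsSplit N P Q) (hN : N.Nodup) {i : α}
    (hi : i ∈ P) : 2 * P.idxOf i ≤ N.idxOf i := by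
  rcases h with ⟨rfl, rfl⟩ | ⟨rfl, rfl⟩
  · exact two_mul_idxOf_oddPart_le i hN hi
  · exact two_mul_idxOf_evenPart_le i hN hi

end IsSplit

theorem idxOf_reverse_add {α : Type} [DecidableEq α] {l : List α} (hl : l.Nodup) {i : α}
    (hi : i ∈ l) : l.reverse.idxOf i + l.idxOf i + 1 = l.length := by
  have h := List.idxOf_lt_length_of_mem hi
  have hget : l[l.idxOf i] = i := List.getElem_idxOf h
  have hr : l.reverse[l.length - 1 - l.idxOf i]'(by simp; omega) = i := by
    rw [List.getElem_reverse]
    simp only [show l.length - 1 - (l.length - 1 - l.idxOf i) = l.idxOf i by omega, hget]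
  have := (List.nodup_reverse.2 hl).idxOf_getElem (l.length - 1 - l.idxOf i) (by simp; omega)
  rw [hr] at this
  omega

/-! ### Planting -/

/-- `T` arises from the tentative bundles `A` by moving the favorite item of each agent `j` of `N`
to the agent `dest j`. -/
def IsPlanting (p : Profile n m) (N : List (Fin n)) (A T : Allocation n m)
    (dest : Fin n → Fin n) : Prop :=
  ∀ i ∈ N, ∀ x, x ∈ T i ↔
    (x ∈ A i ∧ x ∉ favorite (p i) (A i)) ∨ ∃ j ∈ N, dest j = i ∧ x ∈ favorite (p j) (A j)

theorem foldl_plantPair_of_notMem (p : Profile n m) {i : Fin n} :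
    ∀ (N : List (Fin n)) (A : Allocation n m), i ∉ N →
      ((oddPart N).zip (evenPart N)).foldl (plantPair p) A i = A i
  | [], A, _ => by simp [oddPart]
  | [a], A, _ => by simp [evenPart]
  | a :: b :: L, A, h => by
      simp only [List.mem_cons, not_or] at h
      simp only [oddPart, evenPart, List.zip_cons_cons, List.foldl_cons]
      rw [foldl_plantPair_of_notMem p L _ h.2.2]
      simp [plantPair, Function.update_of_ne h.1, Function.update_of_ne h.2.1]

/-- In a list of odd length the last agent has no partner, so no exchange touches its bundle. -/
theorem foldl_plantPair_getLast (p : Profile n m) {i : Fin n} :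
    ∀ (N : List (Fin n)) (A : Allocation n m), N.Nodup → N.length % 2 = 1 →
      N.getLast? = some i → ((oddPart N).zip (evenPart N)).foldl (plantPair p) A i = A i
  | [], A, _, h, _ => by simp at h
  | [a], A, _, _, _ => by simp [evenPart]
  | a :: b :: L, A, hN, hl, hi => by
      simp only [List.nodup_cons, List.mem_cons, not_or] at hN
      simp only [oddPart, evenPart, List.zip_cons_cons, List.foldl_cons]
      have hL : L ≠ [] := by
        rintro rfl
        simp at hl
      have hi' : L.getLast? = some i := by
        obtain ⟨c, L', rfl⟩ := List.exists_cons_of_ne_nil hL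
        simpa [List.getLast?_cons_cons] using hi
      have hiL : i ∈ L := List.mem_of_getLast? hi'
      rw [foldl_plantPair_getLast p L _ hN.2.2 (by simp only [List.length_cons] at hl; omega) hi']
      have h1 : i ≠ a := fun h => hN.1.2 (h ▸ hiL)
      have h2 : i ≠ b := fun h => hN.2.1 (h ▸ hiL)
      simp [plantPair, Function.update_of_ne h1, Function.update_of_ne h2]

/-- Exchanges of different pairs do not interact. An unpaired last agent keeps its favorite, which
is recorded by letting `dest` fix it, until `plant` redirects that item. -/
theorem exists_isPlanting_foldl_plantPair (p : Profile n m) :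
    ∀ (N : List (Fin n)) (A : Allocation n m), N.Nodup → {i | i ∈ N}.PairwiseDisjoint A →
      ∃ dest : Fin n → Fin n,
        (∀ i ∈ oddPart N, dest i ∈ evenPart N ∨ (N.length % 2 = 1 ∧ N.getLast? = some i)) ∧
        (∀ i, N.length % 2 = 1 → N.getLast? = some i → dest i = i) ∧
        (∀ i ∈ evenPart N, dest i ∈ oddPart N) ∧
        IsPlanting p N A (((oddPart N).zip (evenPart N)).foldl (plantPair p) A) dest
  | [], A, _, _ => ⟨id, by simp [oddPart], by simp, by simp [evenPart], by simp [IsPlanting]⟩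
  | [a], A, _, _ => by
      refine ⟨id, by simp [oddPart], by simp, by simp [evenPart], ?_⟩
      intro i hi x
      rw [List.mem_singleton] at hi
      subst hi
      have := @favorite_subset m (p i) (A i) x
      simp only [evenPart, List.zip_nil_right, List.foldl_nil, List.mem_singleton, id,
        exists_eq_left, true_and]
      tauto
  | a :: b :: L, A, hN, hA => by
      have hab : a ≠ b := by
        simp only [List.nodup_cons, List.mem_cons, not_or] at hN
        exact hN.1.1
      have haL : a ∉ L := by
        simp only [List.nodup_cons, List.mem_cons, not_or] at hN
        exact hN.1.2
      have hbL : b ∉ L := by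
        simp only [List.nodup_cons, List.mem_cons, not_or] at hN
        exact hN.2.1
      have hL : L.Nodup := by
        simp only [List.nodup_cons, List.mem_cons, not_or] at hN
        exact hN.2.2
      set A₁ := plantPair p A (a, b) with hA₁
      have hA₁L : ∀ i ∈ L, A₁ i = A i := by
        intro i hi
        have h1 : i ≠ a := fun h => haL (h ▸ hi)
        have h2 : i ≠ b := fun h => hbL (h ▸ hi)
        simp [hA₁, plantPair, Function.update_of_ne h1, Function.update_of_ne h2]
      obtain ⟨d, hd₀, hdl, hd₁, hd⟩ := exists_isPlanting_foldl_plantPair p L A₁ hL (by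
        intro i hi j hj hij
        have hi' : i ∈ L := hi
        have hj' : j ∈ L := hj
        change Disjoint (A₁ i) (A₁ j)
        rw [hA₁L i hi', hA₁L j hj']
        exact hA (by simp [hi']) (by simp [hj']) hij)
      have hdL : ∀ i ∈ L, d i ∈ L := by
        intro i hi
        rcases (mem_oddPart_or_evenPart i L).1 hi with h | h
        · rcases hd₀ i h with h' | h'
          · exact (evenPart_sublist L).subset h'
          · rwa [hdl i h'.1 h'.2]
        · exact (oddPart_sublist L).subset (hd₁ i h)
      -- Ensures that deleting the planted favorite does not also delete the item received in
      -- exchange.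
      have hFdisj : ∀ x, x ∈ favorite (p a) (A a) → x ∉ favorite (p b) (A b) := fun x h1 h2 =>
        Finset.disjoint_left.1 (hA (by simp : a ∈ a :: b :: L) (by simp : b ∈ a :: b :: L) hab)
          (favorite_subset _ _ h1) (favorite_subset _ _ h2)
      refine ⟨fun i => if i = a then b else if i = b then a else d i, ?_, ?_, ?_, ?_⟩
      · simp only [oddPart, evenPart, List.mem_cons]
        rintro i (rfl | hi)
        · simp
        · have hiL := (oddPart_sublist L).subset hi
          have h1 : i ≠ a := fun h => haL (h ▸ hiL)
          have h2 : i ≠ b := fun h => hbL (h ▸ hiL)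
          simp only [h1, h2, if_false, List.length_cons]
          rcases hd₀ i hi with h | h
          · exact Or.inl (Or.inr h)
          · refine Or.inr ⟨by omega, ?_⟩
            obtain ⟨c, L', rfl⟩ := List.exists_cons_of_ne_nil (List.ne_nil_of_mem hiL)
            simpa [List.getLast?_cons_cons] using h.2
      · intro i hodd hi
        have hL' : L ≠ [] := by
          rintro rfl
          simp at hodd
        have hi' : L.getLast? = some i := by
          obtain ⟨c, L', rfl⟩ := List.exists_cons_of_ne_nil hL'
          simpa [List.getLast?_cons_cons] using hi
        have hiL : i ∈ L := List.mem_of_getLast? hi'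
        beta_reduce
        rw [if_neg (fun h : i = a => haL (h ▸ hiL)), if_neg (fun h : i = b => hbL (h ▸ hiL))]
        exact hdl i (by simp only [List.length_cons] at hodd; omega) hi'
      · simp only [oddPart, evenPart, List.mem_cons]
        rintro i (rfl | hi)
        · simp [hab.symm]
        · have hiL := (evenPart_sublist L).subset hi
          have h1 : i ≠ a := fun h => haL (h ▸ hiL)
          have h2 : i ≠ b := fun h => hbL (h ▸ hiL)
          simp only [h1, h2, if_false]
          exact Or.inr (hd₁ i hi)
      · intro i hi x
        simp only [oddPart, evenPart, List.zip_cons_cons, List.foldl_cons, ← hA₁]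
        have hsplit : (∃ j ∈ a :: b :: L, (if j = a then b else if j = b then a else d j) = i ∧
            x ∈ favorite (p j) (A j)) ↔ (b = i ∧ x ∈ favorite (p a) (A a)) ∨
            (a = i ∧ x ∈ favorite (p b) (A b)) ∨
            ∃ j ∈ L, d j = i ∧ x ∈ favorite (p j) (A j) := by
          simp only [List.mem_cons, exists_eq_or_imp, if_true, hab.symm, if_false]
          refine or_congr_right (or_congr_right (exists_congr fun j => and_congr_right fun hj => ?_))
          rw [if_neg (fun h : j = a => haL (h ▸ hj)), if_neg (fun h : j = b => hbL (h ▸ hj))]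
        rw [hsplit]
        rcases List.mem_cons.1 hi with rfl | hi
        · have hno : ¬ ∃ j ∈ L, d j = i ∧ x ∈ favorite (p j) (A j) := by
            rintro ⟨j, hj, rfl, -⟩
            exact haL (hdL j hj)
          rw [foldl_plantPair_of_notMem p L A₁ haL]
          have h1 := hFdisj x
          simp only [hA₁, plantPair, Function.update_of_ne hab, Function.update_self,
            Finset.mem_sdiff, Finset.mem_union, hab.symm, hno]
          tauto
        · rcases List.mem_cons.1 hi with rfl | hi
          · have hno : ¬ ∃ j ∈ L, d j = i ∧ x ∈ favorite (p j) (A j) := by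
              rintro ⟨j, hj, rfl, -⟩
              exact hbL (hdL j hj)
            rw [foldl_plantPair_of_notMem p L A₁ hbL]
            have h1 := hFdisj x
            simp only [hA₁, plantPair, Function.update_self,
              Finset.mem_sdiff, Finset.mem_union, hab, hno]
            tauto
          · have h1 : a ≠ i := fun h => haL (h ▸ hi)
            have h2 : b ≠ i := fun h => hbL (h ▸ hi)
            rw [hd i hi x, hA₁L i hi]
            simp only [h1, h2, false_and, false_or]
            refine or_congr_right (exists_congr fun j => and_congr_right fun hj => ?_)
            rw [hA₁L j hj]

/-- The unpaired last agent lies in `oddPart` and plants with the second agent, the head of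
`evenPart`. Thus every favorite crosses to the other part, from where its owner can steal it back.
-/
theorem exists_isPlanting_plant (p : Profile n m) {N : List (Fin n)} {A : Allocation n m}
    (hN : N.Nodup) (hlen : 2 ≤ N.length) (hA : {i | i ∈ N}.PairwiseDisjoint A) :
    ∃ dest : Fin n → Fin n, (∀ P Q, IsSplit N P Q → ∀ i ∈ P, dest i ∈ Q) ∧
      IsPlanting p N A (plant p N A) dest := by
  obtain ⟨d, hd₀, hdl, hd₁, hd⟩ := exists_isPlanting_foldl_plantPair p N A hN hA
  by_cases hodd : N.length % 2 = 1
  · obtain ⟨z, hz⟩ : ∃ z, N.getLast? = some z :=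
      ⟨_, List.getLast?_eq_getLast_of_ne_nil (by
        rintro rfl
        simp at hlen)⟩
    obtain ⟨b, hb, hbe⟩ : ∃ b, N[1]? = some b ∧ b ∈ evenPart N := by
      match N, hlen with
      | a :: b :: L, _ => exact ⟨b, by simp, by simp [evenPart]⟩
    have hzN : z ∈ N := List.mem_of_getLast? hz
    have hbN : b ∈ N := (evenPart_sublist N).subset hbe
    set B := ((oddPart N).zip (evenPart N)).foldl (plantPair p) A with hB
    have hBz : B z = A z := foldl_plantPair_getLast p N A hN hodd hz
    have hplant : plant p N A = plantOne p B z b := by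
      simp only [plant, hodd, if_true, hz, hb, ← hB]
    -- `d` fixes `z` but maps `evenPart` into `oddPart`.
    have hzo : z ∉ evenPart N := by
      intro hze
      have h1 := hd₁ z hze
      rw [hdl z hodd hz] at h1
      exact disjoint_oddPart_evenPart hN z h1 hze
    have hzb : z ≠ b := fun h => hzo (h ▸ hbe)
    refine ⟨Function.update d z b, ?_, ?_⟩
    · rintro P Q (⟨rfl, rfl⟩ | ⟨rfl, rfl⟩) i hi
      · by_cases hiz : i = z
        · subst hiz
          simpa using hbe
        · rw [Function.update_of_ne hiz]
          rcases hd₀ i hi with h | h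
          · exact h
          · rw [hz] at h
            exact absurd (Option.some_injective _ h.2).symm hiz
      · have hiz : i ≠ z := fun h => hzo (h ▸ hi)
        rw [Function.update_of_ne hiz]
        exact hd₁ i hi
    · intro i hi x
      have hdest : (∃ j ∈ N, Function.update d z b j = i ∧ x ∈ favorite (p j) (A j)) ↔
          (b = i ∧ x ∈ favorite (p z) (A z)) ∨
            ∃ j ∈ N, j ≠ z ∧ d j = i ∧ x ∈ favorite (p j) (A j) := by
        constructor
        · rintro ⟨j, hj, hji, hx⟩
          by_cases hjz : j = z
          · subst hjz
            exact Or.inl ⟨by simpa using hji, hx⟩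
          · exact Or.inr ⟨j, hj, hjz, by rwa [Function.update_of_ne hjz] at hji, hx⟩
        · rintro (⟨h, hx⟩ | ⟨j, hj, hjz, hji, hx⟩)
          · exact ⟨z, hzN, by simpa using h, hx⟩
          · exact ⟨j, hj, by rwa [Function.update_of_ne hjz], hx⟩
      have hd' : i ≠ z → (x ∈ B i ↔ (x ∈ A i ∧ x ∉ favorite (p i) (A i)) ∨
          ∃ j ∈ N, j ≠ z ∧ d j = i ∧ x ∈ favorite (p j) (A j)) := by
        intro hiz
        rw [hd i hi x]
        refine or_congr_right (exists_congr fun j => and_congr_right fun hj => ?_)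
        constructor
        · rintro ⟨hji, hx⟩
          refine ⟨?_, hji, hx⟩
          rintro rfl
          exact hiz (hji.symm.trans (hdl j hodd hz))
        · rintro ⟨-, hji, hx⟩
          exact ⟨hji, hx⟩
      rw [hplant, hdest]
      simp only [plantOne, hBz]
      by_cases hiz : i = z
      · subst hiz
        have hno : ¬ ∃ j ∈ N, j ≠ i ∧ d j = i ∧ x ∈ favorite (p j) (A j) := by
          rintro ⟨j, hj, hjz, hji, hx⟩
          have hxi : x ∈ A i := hBz ▸ (hd i hi x).2 (Or.inr ⟨j, hj, hji, hx⟩)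
          exact Finset.disjoint_left.1 (hA hj hi hjz) (favorite_subset _ _ hx) hxi
        simp [hno, hzb.symm]
      · rw [Function.update_of_ne hiz]
        by_cases hib : i = b
        · subst hib
          rw [Function.update_self, Finset.mem_union, hd' hiz]
          simp only [true_and]
          rw [or_assoc]
          exact or_congr_right or_comm
        · rw [Function.update_of_ne hib, hd' hiz]
          simp [Ne.symm hib]
  · refine ⟨d, ?_, ?_⟩
    · rintro P Q (⟨rfl, rfl⟩ | ⟨rfl, rfl⟩) i hi
      · exact (hd₀ i hi).resolve_right fun h => hodd h.1
      · exact hd₁ i hi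
    · simpa only [plant, hodd, if_false] using hd

theorem eq_of_mem_of_pairwiseDisjoint {A : Allocation n m} {s : Set (Fin n)}
    (hA : s.PairwiseDisjoint A) {i j : Fin n} (hi : i ∈ s) (hj : j ∈ s) {x : Fin m}
    (hxi : x ∈ A i) (hxj : x ∈ A j) : i = j := by
  by_contra h
  exact Finset.disjoint_left.1 (hA hi hj h) hxi hxj

/-- An item has a single owner in `A`, and from there it either stays or goes to the one place
`dest` names. -/
theorem pairwiseDisjoint_plant (p : Profile n m) {N : List (Fin n)} {A : Allocation n m}
    (hN : N.Nodup) (hlen : 2 ≤ N.length) (hA : {i | i ∈ N}.PairwiseDisjoint A) :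
    {i | i ∈ N}.PairwiseDisjoint (plant p N A) := by
  obtain ⟨d, -, hd⟩ := exists_isPlanting_plant p hN hlen hA
  intro i hi j hj hij
  refine Finset.disjoint_left.2 fun x hxi hxj => hij ?_
  rcases (hd i hi x).1 hxi with ⟨h1, h2⟩ | ⟨k, hk, rfl, h1⟩ <;>
    rcases (hd j hj x).1 hxj with ⟨h3, h4⟩ | ⟨l, hl, rfl, h3⟩
  · exact eq_of_mem_of_pairwiseDisjoint hA hi hj h1 h3
  · have := eq_of_mem_of_pairwiseDisjoint hA hi hl h1 (favorite_subset _ _ h3)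
    subst this
    exact absurd h3 h2
  · have := eq_of_mem_of_pairwiseDisjoint hA hj hk h3 (favorite_subset _ _ h1)
    subst this
    exact absurd h1 h4
  · rw [eq_of_mem_of_pairwiseDisjoint hA hk hl (favorite_subset _ _ h1) (favorite_subset _ _ h3)]

theorem pool_plant (p : Profile n m) {N : List (Fin n)} {A : Allocation n m}
    (hN : N.Nodup) (hlen : 2 ≤ N.length) (hA : {i | i ∈ N}.PairwiseDisjoint A) :
    pool (plant p N A) N = pool A N := by
  obtain ⟨d, hs, hd⟩ := exists_isPlanting_plant p hN hlen hA
  ext x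
  simp only [mem_pool]
  constructor
  · rintro ⟨i, hi, hx⟩
    rcases (hd i hi x).1 hx with ⟨h1, -⟩ | ⟨j, hj, -, h1⟩
    · exact ⟨i, hi, h1⟩
    · exact ⟨j, hj, favorite_subset _ _ h1⟩
  · rintro ⟨i, hi, hx⟩
    by_cases hf : x ∈ favorite (p i) (A i)
    · have hdi : d i ∈ N := by
        have hsp : IsSplit N (oddPart N) (evenPart N) := Or.inl ⟨rfl, rfl⟩
        rcases (hsp.mem_iff i).1 hi with h | h
        · exact (hsp.mem_iff _).2 (Or.inr (hs _ _ hsp i h))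
        · exact (hsp.mem_iff _).2 (Or.inl (hs _ _ hsp.symm i h))
      exact ⟨d i, hdi, (hd _ hdi x).2 (Or.inr ⟨i, hi, rfl, hf⟩)⟩
    · exact ⟨i, hi, (hd i hi x).2 (Or.inl ⟨hx, hf⟩)⟩

theorem disjoint_pool_pool {N P Q : List (Fin n)} (h : IsSplit N P Q) (hN : N.Nodup)
    {T : Allocation n m} (hT : {i | i ∈ N}.PairwiseDisjoint T) :
    Disjoint (pool T P) (pool T Q) := by
  refine Finset.disjoint_left.2 fun x hP hQ => ?_
  obtain ⟨i, hi, hxi⟩ := mem_pool.1 hP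
  obtain ⟨j, hj, hxj⟩ := mem_pool.1 hQ
  have := eq_of_mem_of_pairwiseDisjoint hT ((h.mem_iff i).2 (Or.inl hi))
    ((h.mem_iff j).2 (Or.inr hj)) hxi hxj
  subst this
  exact h.notMem hN hi hj

/-! ### The bundles allocated by the recursion -/

/-- The bundles that the recursion adds to those allocated before. -/
noncomputable def share (r p : Profile n m) (first : Bool) (N : List (Fin n)) (A : Allocation n m) :
    Allocation n m :=
  splitPlantSteal r p first N A fun _ => ∅

/-- The accumulator is only ever enlarged by unions and never read otherwise, so it can be split off
and `share` studied alone. -/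
theorem splitPlantSteal_eq_union_share (r p : Profile n m) (first : Bool) (N : List (Fin n))
    (A X : Allocation n m) (i : Fin n) :
    splitPlantSteal r p first N A X i = X i ∪ share r p first N A i := by
  induction hl : N.length using Nat.strong_induction_on generalizing first N A X i with
  | _ l ih =>
  match N with
  | [] => simp [share, splitPlantSteal]
  | [a] =>
    simp only [share, splitPlantSteal, Finset.empty_union]
    by_cases h : i = a
    · subst h
      simp
    · simp [Function.update_of_ne h]
  | a :: b :: L =>
    have h₀ : ∀ A X i, splitPlantSteal r p false (if first then (oddPart (a :: b :: L)).reverse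
        else oddPart (a :: b :: L)) A X i = X i ∪ share r p false (if first then
        (oddPart (a :: b :: L)).reverse else oddPart (a :: b :: L)) A i := by
      intro A X i
      refine ih _ ?_ _ _ _ _ _ rfl
      subst hl
      split <;> simp only [List.length_reverse, length_oddPart, List.length_cons] <;> omega
    have h₁ : ∀ A X i, splitPlantSteal r p false (if first then (evenPart (a :: b :: L)).reverse
        else evenPart (a :: b :: L)) A X i = X i ∪ share r p false (if first then
        (evenPart (a :: b :: L)).reverse else evenPart (a :: b :: L)) A i := by
      intro A X i
      refine ih _ ?_ _ _ _ _ _ rfl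
      subst hl
      split <;> simp only [List.length_reverse, length_evenPart, List.length_cons] <;> omega
    unfold share
    rw [splitPlantSteal, splitPlantSteal]
    simp only [h₀, h₁, Finset.empty_union, Finset.union_assoc]

theorem share_nil (r p : Profile n m) (first : Bool) (A : Allocation n m) (i : Fin n) :
    share r p first [] A i = ∅ := by
  simp [share, splitPlantSteal]

theorem share_singleton (r p : Profile n m) (first : Bool) (A : Allocation n m) (i : Fin n) :
    share r p first [i] A i = A i := by
  simp [share, splitPlantSteal]

theorem share_eq_of_two_le (r p : Profile n m) (first : Bool) {N : List (Fin n)}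
    (hlen : 2 ≤ N.length) (A : Allocation n m) (i : Fin n) :
    share r p first N A i =
      steal r (oddPart N) (evenPart N) (plant p N A) i ∪
        (share r p false (if first then (oddPart N).reverse else oddPart N)
          (fun j => plant p N A j \ pool (steal r (oddPart N) (evenPart N) (plant p N A)) N) i ∪
        share r p false (if first then (evenPart N).reverse else evenPart N)
          (fun j => plant p N A j \
            pool (steal r (oddPart N) (evenPart N) (plant p N A)) N) i) := by
  match N with
  | a :: b :: L =>
    conv_lhs => unfold share
    rw [splitPlantSteal]
    simp only [splitPlantSteal_eq_union_share, Finset.empty_union, Finset.union_assoc]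

theorem share_of_notMem (r p : Profile n m) (first : Bool) {N : List (Fin n)}
    (A : Allocation n m) {i : Fin n} (hi : i ∉ N) : share r p first N A i = ∅ := by
  induction hl : N.length using Nat.strong_induction_on generalizing first N A with
  | _ l ih =>
  match N with
  | [] => exact share_nil ..
  | [a] =>
    simp only [List.mem_singleton] at hi
    simp [share, splitPlantSteal, Function.update_of_ne hi]
  | a :: b :: L =>
    have ho : i ∉ oddPart (a :: b :: L) := fun h => hi ((oddPart_sublist _).subset h)
    have he : i ∉ evenPart (a :: b :: L) := fun h => hi ((evenPart_sublist _).subset h)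
    rw [share_eq_of_two_le _ _ _ (by simp)]
    rw [ih _ _ _ _ _ rfl, ih _ _ _ _ _ rfl]
    · simp [steal, allocateBest_of_notMem _ _ ho, allocateBest_of_notMem _ _ he]
    · subst hl
      split <;> simp only [List.length_reverse, length_evenPart, List.length_cons] <;> omega
    · split <;> simpa using he
    · subst hl
      split <;> simp only [List.length_reverse, length_oddPart, List.length_cons] <;> omega
    · split <;> simpa using ho

theorem foldl_plantPair_congr (p : Profile n m) :
    ∀ (N : List (Fin n)) {A B : Allocation n m}, (∀ i ∈ N, A i = B i) → ∀ i ∈ N,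
      ((oddPart N).zip (evenPart N)).foldl (plantPair p) A i =
        ((oddPart N).zip (evenPart N)).foldl (plantPair p) B i
  | [], A, B, _ => by simp
  | [a], A, B, h => by simpa [evenPart] using h
  | a :: b :: L, A, B, h => by
      have ha := h a (by simp)
      have hb := h b (by simp)
      have h' : ∀ i ∈ a :: b :: L, plantPair p A (a, b) i = plantPair p B (a, b) i := by
        intro i hi
        simp only [plantPair, Function.update_apply, ha, hb, h i hi]
      intro i hi
      simp only [oddPart, evenPart, List.zip_cons_cons, List.foldl_cons]
      by_cases hiL : i ∈ L
      · exact foldl_plantPair_congr p L (fun j hj => h' j (by simp [hj])) i hiL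
      · rw [foldl_plantPair_of_notMem p L _ hiL, foldl_plantPair_of_notMem p L _ hiL]
        exact h' i hi

theorem plant_congr (p : Profile n m) {N : List (Fin n)} {A B : Allocation n m}
    (h : ∀ i ∈ N, A i = B i) : ∀ i ∈ N, plant p N A i = plant p N B i := by
  have hf := foldl_plantPair_congr p N h
  intro i hi
  unfold plant
  split
  · rcases ha : N.getLast? with _ | a
    · exact hf i hi
    · rcases hb : N[1]? with _ | b
      · exact hf i hi
      · have ha' := List.mem_of_getLast? ha
        have hb' := List.mem_of_getElem? hb
        simp only [plantOne, Function.update_apply, hf a ha', hf b hb', hf i hi]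
  · exact hf i hi

/-- The recursion reads the tentative bundles of its own agents only, so the common updated
allocation may be replaced by the `leftover` of one part. -/
theorem share_congr (r p : Profile n m) (first : Bool) {N : List (Fin n)}
    {A B : Allocation n m} (h : ∀ i ∈ N, A i = B i) (i : Fin n) :
    share r p first N A i = share r p first N B i := by
  induction hl : N.length using Nat.strong_induction_on generalizing first N A B with
  | _ l ih =>
  match N with
  | [] => simp [share_nil]
  | [a] =>
    simp only [share, splitPlantSteal, h a (by simp)]
  | a :: b :: L =>
    have hp := plant_congr p h
    have hs : steal r (oddPart (a :: b :: L)) (evenPart (a :: b :: L))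
        (plant p (a :: b :: L) A) = steal r (oddPart (a :: b :: L)) (evenPart (a :: b :: L))
        (plant p (a :: b :: L) B) := by
      funext j
      unfold steal
      rw [pool_congr fun i hi => hp i ((oddPart_sublist _).subset hi),
        pool_congr fun i hi => hp i ((evenPart_sublist _).subset hi)]
    have hlen : 2 ≤ (a :: b :: L).length := by simp
    rw [share_eq_of_two_le r p first hlen A, share_eq_of_two_le r p first hlen B, hs]
    congr 2
    · refine ih _ ?_ _ ?_ rfl
      · subst hl
        split <;> simp only [List.length_reverse, length_oddPart, List.length_cons] <;> omega
      · intro j hj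
        rw [hp j ((oddPart_sublist _).subset (by split at hj <;> simpa using hj))]
    · refine ih _ ?_ _ ?_ rfl
      · subst hl
        split <;> simp only [List.length_reverse, length_evenPart, List.length_cons] <;> omega
      · intro j hj
        rw [hp j ((evenPart_sublist _).subset (by split at hj <;> simpa using hj))]

/-- The bundles left to the agents of the part `P` after the agents of `Q` have stolen. -/
noncomputable def leftover (r : Profile n m) (P Q : List (Fin n)) (T : Allocation n m) :
    Allocation n m :=
  fun j => T j \ pool (allocateBest r Q (pool T P)) Q

/-- The agents of `P` steal from the pool of `Q`, which is disjoint from the bundles of `P`; only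
the thefts by `Q` matter for these. -/
theorem sdiff_pool_steal (r : Profile n m) {N P Q : List (Fin n)} (h : IsSplit N P Q)
    (hN : N.Nodup) {T : Allocation n m} (hT : {i | i ∈ N}.PairwiseDisjoint T) :
    ∀ j ∈ P, T j \ pool (steal r (oddPart N) (evenPart N) T) N = leftover r P Q T j := by
  have hS : ∀ i, steal r (oddPart N) (evenPart N) T i =
      allocateBest r P (pool T Q) i ∪ allocateBest r Q (pool T P) i := by
    rcases h with ⟨rfl, rfl⟩ | ⟨rfl, rfl⟩
    · exact fun _ => rfl
    · exact fun _ => Finset.union_comm _ _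
  intro j hj
  ext x
  simp only [leftover, Finset.mem_sdiff]
  refine and_congr_right fun hx => not_congr ?_
  simp only [mem_pool, hS, Finset.mem_union]
  constructor
  · rintro ⟨i, -, h1 | h1⟩
    · exact absurd (allocateBest_subset _ _ _ _ h1)
        (Finset.disjoint_left.1 (disjoint_pool_pool h hN hT) (mem_pool.2 ⟨j, hj, hx⟩))
    · by_cases hi : i ∈ Q
      · exact ⟨i, hi, h1⟩
      · simp [allocateBest_of_notMem _ _ hi] at h1
  · rintro ⟨i, hi, h1⟩
    exact ⟨i, (h.mem_iff i).2 (Or.inr hi), Or.inr h1⟩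

/-- One level of the recursion, seen by an agent `i` of the part `P`. -/
theorem share_eq_of_isSplit (r p : Profile n m) (first : Bool) {N P Q : List (Fin n)}
    (h : IsSplit N P Q) (hN : N.Nodup) (hlen : 2 ≤ N.length) {A : Allocation n m}
    (hA : {i | i ∈ N}.PairwiseDisjoint A) {i : Fin n} (hi : i ∈ P) :
    share r p first N A i = allocateBest r P (pool (plant p N A) Q) i ∪
      share r p false (if first then P.reverse else P) (leftover r P Q (plant p N A)) i := by
  have hiQ := h.notMem hN hi
  have hT := pairwiseDisjoint_plant p hN hlen hA
  have hsd := sdiff_pool_steal r h hN hT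
  rw [share_eq_of_two_le _ _ _ hlen]
  have hP : ∀ j ∈ (if first then P.reverse else P), plant p N A j \
      pool (steal r (oddPart N) (evenPart N) (plant p N A)) N =
      leftover r P Q (plant p N A) j := by
    intro j hj
    exact hsd j (by split at hj <;> simpa using hj)
  rw [← share_congr r p false hP i]
  have hQ : ∀ B : Allocation n m, share r p false (if first then Q.reverse else Q) B i = ∅ :=
    fun B => share_of_notMem _ _ _ _ (by split <;> simpa using hiQ)
  rcases h with ⟨rfl, rfl⟩ | ⟨rfl, rfl⟩
  · rw [hQ]
    simp [steal, allocateBest_of_notMem _ _ hiQ]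
  · rw [hQ]
    simp [steal, allocateBest_of_notMem _ _ hiQ]

/-! ### Induction along the recursion -/

theorem mem_ite_reverse {α : Type} (b : Bool) (P : List α) (i : α) :
    i ∈ (if b then P.reverse else P) ↔ i ∈ P := by
  split <;> simp

theorem nodup_ite_reverse {α : Type} (b : Bool) {P : List α} (h : P.Nodup) :
    (if b then P.reverse else P).Nodup := by
  split <;> simpa using h

theorem length_ite_reverse {α : Type} (b : Bool) (P : List α) :
    (if b then P.reverse else P).length = P.length := by
  split <;> simp

theorem IsSplit.nodup {α : Type} {N P Q : List α} (h : IsSplit N P Q) (hN : N.Nodup) :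
    P.Nodup :=
  hN.sublist h.sublist

theorem IsSplit.length_lt {α : Type} {N P Q : List α} (h : IsSplit N P Q)
    (hlen : 2 ≤ N.length) : P.length < N.length := by
  have := h.length_le
  omega

theorem exists_isSplit_of_mem {α : Type} {N : List α} {i : α} (hi : i ∈ N) :
    ∃ P Q, IsSplit N P Q ∧ i ∈ P := by
  rcases (mem_oddPart_or_evenPart i N).1 hi with h | h
  · exact ⟨_, _, Or.inl ⟨rfl, rfl⟩, h⟩
  · exact ⟨_, _, Or.inr ⟨rfl, rfl⟩, h⟩

theorem pool_subset_pool_of_isSplit {N P Q : List (Fin n)} (h : IsSplit N P Q)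
    (T : Allocation n m) : pool T P ⊆ pool T N := by
  intro x hx
  obtain ⟨i, hi, hx⟩ := mem_pool.1 hx
  exact mem_pool.2 ⟨i, (h.mem_iff i).2 (Or.inl hi), hx⟩

theorem pairwiseDisjoint_leftover (r : Profile n m) {N P Q : List (Fin n)} (h : IsSplit N P Q)
    {T : Allocation n m} (hT : {i | i ∈ N}.PairwiseDisjoint T) (b : Bool) :
    {i | i ∈ if b then P.reverse else P}.PairwiseDisjoint (leftover r P Q T) := by
  intro i hi j hj hij
  have hi' := (mem_ite_reverse b P i).1 hi
  have hj' := (mem_ite_reverse b P j).1 hj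
  exact (hT ((h.mem_iff i).2 (Or.inl hi')) ((h.mem_iff j).2 (Or.inl hj')) hij).mono
    Finset.sdiff_subset Finset.sdiff_subset

theorem pool_leftover (r : Profile n m) (P Q : List (Fin n)) (T : Allocation n m) (b : Bool) :
    pool (leftover r P Q T) (if b then P.reverse else P) =
      pool T P \ pool (allocateBest r Q (pool T P)) Q := by
  rw [pool_eq_of_mem_iff _ (mem_ite_reverse b P)]
  ext x
  simp only [mem_pool, leftover, Finset.mem_sdiff]
  constructor
  · rintro ⟨i, hi, hx, h⟩
    exact ⟨⟨i, hi, hx⟩, h⟩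
  · rintro ⟨⟨i, hi, hx⟩, h⟩
    exact ⟨i, hi, hx, h⟩

/-- Induction along the recursion, from the parts to the whole. -/
theorem split_induction {motive : Bool → List (Fin n) → Allocation n m → Prop}
    (r p : Profile n m)
    (nil : ∀ first A, motive first [] A)
    (singleton : ∀ first i A, motive first [i] A)
    (step : ∀ (first : Bool) (N : List (Fin n)) (A : Allocation n m), N.Nodup → 2 ≤ N.length →
      {i | i ∈ N}.PairwiseDisjoint A →
      (∀ P Q, IsSplit N P Q →
        motive false (if first then P.reverse else P) (leftover r P Q (plant p N A))) →
      motive first N A)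
    (first : Bool) (N : List (Fin n)) (A : Allocation n m) (hN : N.Nodup)
    (hA : {i | i ∈ N}.PairwiseDisjoint A) : motive first N A := by
  induction hl : N.length using Nat.strong_induction_on generalizing first N A with
  | _ l ih =>
  match N with
  | [] => exact nil _ _
  | [a] => exact singleton _ _ _
  | a :: b :: L =>
    have hlen : 2 ≤ (a :: b :: L).length := by simp
    refine step first _ A hN hlen hA fun P Q h => ih _ ?_ _ _ _ ?_ ?_ rfl
    · rw [length_ite_reverse, ← hl]
      exact h.length_lt hlen
    · exact nodup_ite_reverse _ (h.nodup hN)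
    · exact pairwiseDisjoint_leftover r h (pairwiseDisjoint_plant p hN hlen hA) _

/-! ### The recursion partitions the tentative items -/

theorem share_subset_pool (r p : Profile n m) (first : Bool) {N : List (Fin n)}
    {A : Allocation n m} (hN : N.Nodup) (hA : {i | i ∈ N}.PairwiseDisjoint A) (i : Fin n) :
    share r p first N A i ⊆ pool A N := by
  by_cases hi : i ∈ N
  swap
  · simp [share_of_notMem _ _ _ _ hi]
  revert hi
  refine split_induction (motive := fun first N A => i ∈ N → share r p first N A i ⊆ pool A N)
    r p ?_ ?_ ?_ first N A hN hA
  · simp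
  · intro first j A hi
    rw [List.mem_singleton] at hi
    subst hi
    rw [share_singleton]
    intro x hx
    exact mem_pool.2 ⟨i, by simp, hx⟩
  · intro first N A hN hlen hA ih hi
    obtain ⟨P, Q, h, hiP⟩ := exists_isSplit_of_mem hi
    rw [share_eq_of_isSplit r p first h hN hlen hA hiP, ← pool_plant p hN hlen hA]
    refine Finset.union_subset ?_ ?_
    · exact (allocateBest_subset _ _ _ _).trans (pool_subset_pool_of_isSplit h.symm _)
    · refine (ih P Q h ((mem_ite_reverse _ _ _).2 hiP)).trans ?_
      rw [pool_leftover]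
      exact Finset.sdiff_subset.trans (pool_subset_pool_of_isSplit h _)

theorem share_leftover_subset (r p : Profile n m) (first : Bool) {N P Q : List (Fin n)}
    (h : IsSplit N P Q) (hN : N.Nodup) {T : Allocation n m}
    (hT : {i | i ∈ N}.PairwiseDisjoint T) (i : Fin n) :
    share r p false (if first then P.reverse else P) (leftover r P Q T) i ⊆
      pool T P \ pool (allocateBest r Q (pool T P)) Q := by
  rw [← pool_leftover r P Q T first]
  exact share_subset_pool r p false (nodup_ite_reverse _ (h.nodup hN))
    (pairwiseDisjoint_leftover r h hT _) i

theorem disjoint_allocateBest_share (r p : Profile n m) (first : Bool) {N P Q : List (Fin n)}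
    (h : IsSplit N P Q) (hN : N.Nodup) {T : Allocation n m}
    (hT : {i | i ∈ N}.PairwiseDisjoint T) (w : Profile n m) (i j : Fin n) :
    Disjoint (allocateBest w P (pool T Q) i)
      (share r p false (if first then P.reverse else P) (leftover r P Q T) j) :=
  (disjoint_pool_pool h hN hT).symm.mono (allocateBest_subset _ _ _ _)
    ((share_leftover_subset r p first h hN hT j).trans Finset.sdiff_subset)

theorem pairwiseDisjoint_share (r p : Profile n m) (first : Bool) {N : List (Fin n)}
    {A : Allocation n m} (hN : N.Nodup) (hA : {i | i ∈ N}.PairwiseDisjoint A) :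
    {i | i ∈ N}.PairwiseDisjoint (share r p first N A) := by
  refine split_induction (motive := fun first N A =>
    {i | i ∈ N}.PairwiseDisjoint (share r p first N A)) r p ?_ ?_ ?_ first N A hN hA
  · intro first A i hi
    simp at hi
  · intro first a A i hi j hj hij
    simp only [List.mem_singleton, Set.mem_ofPred_eq] at hi hj
    exact absurd (hi.trans hj.symm) hij
  · intro first N A hN hlen hA ih i hi j hj hij
    have hT := pairwiseDisjoint_plant p hN hlen hA
    change Disjoint (share r p first N A i) (share r p first N A j)
    obtain ⟨P, Q, h, hiP⟩ := exists_isSplit_of_mem hi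
    rw [share_eq_of_isSplit r p first h hN hlen hA hiP]
    rcases (h.mem_iff j).1 hj with hjP | hjQ
    · rw [share_eq_of_isSplit r p first h hN hlen hA hjP, Finset.disjoint_union_left,
        Finset.disjoint_union_right, Finset.disjoint_union_right]
      exact ⟨⟨disjoint_allocateBest _ _ _ hij, disjoint_allocateBest_share r p first h hN hT r i j⟩,
        (disjoint_allocateBest_share r p first h hN hT r j i).symm,
        ih P Q h ((mem_ite_reverse _ _ _).2 hiP) ((mem_ite_reverse _ _ _).2 hjP) hij⟩
    · have hPQ := disjoint_pool_pool h hN hT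
      -- What `Q` steals is deleted from the bundles of `P` before `P` recurses.
      have key : ∀ {P Q : List (Fin n)} {i j : Fin n}, IsSplit N P Q → j ∈ Q →
          Disjoint (share r p false (if first then P.reverse else P)
            (leftover r P Q (plant p N A)) i) (allocateBest r Q (pool (plant p N A) P) j) := by
        intro P Q i j h hj
        refine Finset.disjoint_left.2 fun x hx hx' => ?_
        exact (Finset.mem_sdiff.1 (share_leftover_subset r p first h hN hT i hx)).2
          (mem_pool.2 ⟨j, hj, hx'⟩)
      rw [share_eq_of_isSplit r p first h.symm hN hlen hA hjQ, Finset.disjoint_union_left,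
        Finset.disjoint_union_right, Finset.disjoint_union_right]
      exact ⟨⟨hPQ.symm.mono (allocateBest_subset _ _ _ _) (allocateBest_subset _ _ _ _),
        (key h.symm hiP).symm⟩, key h hjQ,
        hPQ.mono ((share_leftover_subset r p first h hN hT i).trans Finset.sdiff_subset)
          ((share_leftover_subset r p first h.symm hN hT j).trans Finset.sdiff_subset)⟩

theorem exists_mem_share (r p : Profile n m) (first : Bool) {N : List (Fin n)}
    {A : Allocation n m} (hN : N.Nodup) (hA : {i | i ∈ N}.PairwiseDisjoint A) {x : Fin m}
    (hx : x ∈ pool A N) : ∃ i ∈ N, x ∈ share r p first N A i := by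
  revert hx
  refine split_induction (motive := fun first N A =>
    x ∈ pool A N → ∃ i ∈ N, x ∈ share r p first N A i) r p ?_ ?_ ?_ first N A hN hA
  · simp
  · intro first a A hx
    refine ⟨a, by simp, ?_⟩
    rw [share_singleton]
    simpa using hx
  · intro first N A hN hlen hA ih hx
    rw [← pool_plant p hN hlen hA] at hx
    obtain ⟨j, hj, hxj⟩ := mem_pool.1 hx
    obtain ⟨P, Q, h, hjP⟩ := exists_isSplit_of_mem hj
    by_cases hst : x ∈ pool (allocateBest r Q (pool (plant p N A) P)) Q
    · obtain ⟨i, hi, hxi⟩ := mem_pool.1 hst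
      refine ⟨i, (h.mem_iff i).2 (Or.inr hi), ?_⟩
      rw [share_eq_of_isSplit r p first h.symm hN hlen hA hi]
      exact Finset.mem_union_left _ hxi
    · obtain ⟨i, hi, hxi⟩ := ih P Q h (by
        rw [pool_leftover]
        exact Finset.mem_sdiff.2 ⟨mem_pool.2 ⟨j, hjP, hxj⟩, hst⟩)
      have hiP := (mem_ite_reverse _ _ _).1 hi
      refine ⟨i, (h.mem_iff i).2 (Or.inl hiP), ?_⟩
      rw [share_eq_of_isSplit r p first h hN hlen hA hiP]
      exact Finset.mem_union_right _ hxi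

/-- At each level the pool from which `i` steals and the bundles passed on to its part are the same
for both reports, so the gains from honest picks simply add up. -/
theorem value_share_le_of_update (r p : Profile n m) (first : Bool) {N : List (Fin n)}
    {A : Allocation n m} (hN : N.Nodup) (hA : {i | i ∈ N}.PairwiseDisjoint A) {i : Fin n}
    (hi : i ∈ N) (u : Valuation m) :
    value u (share r p first N A i) ≤
      value u (share (Function.update r i u) p first N A i) := by
  revert hi
  refine split_induction (motive := fun first N A => i ∈ N → value u (share r p first N A i) ≤
      value u (share (Function.update r i u) p first N A i)) r p ?_ ?_ ?_ first N A hN hA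
  · simp
  · intro first a A hi
    rw [List.mem_singleton] at hi
    subst hi
    rw [share_singleton, share_singleton]
  · intro first N A hN hlen hA ih hi
    have hT := pairwiseDisjoint_plant p hN hlen hA
    obtain ⟨P, Q, h, hiP⟩ := exists_isSplit_of_mem hi
    -- The leftovers of `P` depend only on the reports of `Q`, to which `i` does not belong.
    have hleft : leftover (Function.update r i u) P Q (plant p N A) =
        leftover r P Q (plant p N A) := by
      unfold leftover
      rw [allocateBest_congr (v := Function.update r i u) (w := r) _ fun j hj =>
        Function.update_of_ne (fun hji : j = i => h.notMem hN hiP (hji ▸ hj)) _ _]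
    rw [share_eq_of_isSplit r p first h hN hlen hA hiP,
      share_eq_of_isSplit _ p first h hN hlen hA hiP,
      value_union u (disjoint_allocateBest_share _ p first h hN hT _ i i),
      value_union u (disjoint_allocateBest_share _ p first h hN hT _ i i), hleft]
    exact add_le_add (value_allocateBest_le _ _ _ _ _) (ih P Q h ((mem_ite_reverse _ _ _).2 hiP))

/-! ### Items from an upward closed set -/

/-- If agent `i` receives no item of `K` at one level, then few items of `K` are lost to it. -/
theorem card_inter_pool_le (r p : Profile n m) {N P Q : List (Fin n)} (h : IsSplit N P Q)
    (hN : N.Nodup) (hlen : 2 ≤ N.length) {A : Allocation n m}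
    (hA : {i | i ∈ N}.PairwiseDisjoint A) {i : Fin n} (hi : i ∈ P) {K : Finset (Fin m)}
    (hK : ∀ x ∈ K, ∀ y, r i x ≤ r i y → y ∈ K) (first : Bool)
    (hno : ∀ x ∈ allocateBest r P (pool (plant p N A) Q) i, x ∉ K) :
    (K ∩ pool A N).card ≤ (K ∩ pool (leftover r P Q (plant p N A))
      (if first then P.reverse else P)).card + Q.length + P.idxOf i := by
  set T := plant p N A
  obtain ⟨R, hR, hcard, hfav⟩ := exists_allocateBest_eq_favorite r (pool T Q) hi
  -- An item of `K` in `R` would put the favorite of `R`, which is at least as good, into `K`; but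
  -- that favorite is the pick of `i`.
  have hRK : ∀ x ∈ R, x ∉ K := by
    intro x hx hxK
    obtain ⟨y, hy, hyf, hb⟩ := exists_favorite (r i) ⟨x, hx⟩
    have hyf' : y ∈ favorite (r i) R := by simp [hyf]
    exact hno y (hfav ▸ hyf') (hK x hxK y (le_of_mem_favorite hyf' hx))
  have hstolen : (pool (allocateBest r Q (pool T P)) Q).card ≤ Q.length := by
    refine Finset.card_biUnion_le.trans ((Finset.sum_le_card_nsmul _ _ 1 fun j _ =>
      card_allocateBest_le_one _ _ _ _).trans ?_)
    simpa using List.toFinset_card_le Q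
  -- The losses are the thefts by `Q`, at most `|Q|`, and the items of the pool of `Q` gone before
  -- the turn of `i`, at most its position.
  have hsub : K ∩ pool A N ⊆ (K ∩ pool (leftover r P Q T) (if first then P.reverse else P)) ∪
      pool (allocateBest r Q (pool T P)) Q ∪ (pool T Q \ R) := by
    intro x hx
    rw [Finset.mem_inter, ← pool_plant p hN hlen hA] at hx
    obtain ⟨hxK, hxT⟩ := hx
    obtain ⟨j, hj, hxj⟩ := mem_pool.1 hxT
    rw [pool_leftover]
    simp only [Finset.mem_union, Finset.mem_inter, Finset.mem_sdiff]
    rcases (h.mem_iff j).1 hj with hj | hj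
    · by_cases hst : x ∈ pool (allocateBest r Q (pool T P)) Q
      · exact Or.inl (Or.inr hst)
      · exact Or.inl (Or.inl ⟨hxK, mem_pool.2 ⟨j, hj, hxj⟩, hst⟩)
    · exact Or.inr ⟨mem_pool.2 ⟨j, hj, hxj⟩, fun hxR => hRK x hxR hxK⟩
  have h1 := (Finset.card_le_card hsub).trans (Finset.card_union_le _ _)
  have h2 := Finset.card_union_le (K ∩ pool (leftover r P Q T)
    (if first then P.reverse else P)) (pool (allocateBest r Q (pool T P)) Q)
  omega

/-- The bound reproduces itself: from `|N| + idx_N` at most `|Q| + idx_P` is lost, and `|N| = |P| +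
|Q|` with `2 idx_P ≤ idx_N` leaves `|P| + idx_P`. For a single agent it says that an item of `K` is
left. -/
theorem exists_mem_share_inter (r p : Profile n m) {N : List (Fin n)}
    {A : Allocation n m} (hN : N.Nodup) (hA : {i | i ∈ N}.PairwiseDisjoint A) {i : Fin n}
    (hi : i ∈ N) {K : Finset (Fin m)} (hK : ∀ x ∈ K, ∀ y, r i x ≤ r i y → y ∈ K)
    (hcard : N.length + N.idxOf i ≤ (K ∩ pool A N).card) :
    ∃ x ∈ share r p false N A i, x ∈ K := by
  -- The motive of `split_induction` must allow any flag; the equation pins it to the levels without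
  -- reversal.
  suffices H : ∀ first, first = false → i ∈ N → N.length + N.idxOf i ≤ (K ∩ pool A N).card →
      ∃ x ∈ share r p first N A i, x ∈ K from H false rfl hi hcard
  clear hcard hi
  intro first
  refine split_induction (motive := fun first N A => first = false → i ∈ N →
      N.length + N.idxOf i ≤ (K ∩ pool A N).card →
      ∃ x ∈ share r p first N A i, x ∈ K) r p ?_ ?_ ?_ first N A hN hA
  · simp
  · intro first a A _ hi hcard
    rw [List.mem_singleton] at hi
    subst hi
    obtain ⟨x, hx⟩ := Finset.card_pos.1 (lt_of_lt_of_le (by simp) hcard)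
    rw [Finset.mem_inter, mem_pool] at hx
    rw [share_singleton]
    exact ⟨x, by simpa using hx.2, hx.1⟩
  · rintro first N A hN hlen hA ih rfl hi hcard
    obtain ⟨P, Q, h, hiP⟩ := exists_isSplit_of_mem hi
    rw [share_eq_of_isSplit r p false h hN hlen hA hiP]
    by_cases hno : ∀ x ∈ allocateBest r P (pool (plant p N A) Q) i, x ∉ K
    · have h1 := card_inter_pool_le r p h hN hlen hA hiP hK false hno
      have h2 := h.length_add
      have h3 := h.two_mul_idxOf_le hN hiP
      obtain ⟨x, hx, hxK⟩ := ih P Q h rfl (by simpa using hiP) (by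
        simp only [Bool.false_eq_true, if_false] at h1 ⊢
        omega)
      exact ⟨x, Finset.mem_union_right _ hx, hxK⟩
    · push Not at hno
      obtain ⟨x, hx, hxK⟩ := hno
      exact ⟨x, Finset.mem_union_left _ hx, hxK⟩

/-- An agent at position `t` of `P` loses at most `|Q| + t` items here and then, at position `|P| -
1 - t`, needs `|P| + |P| - 1 - t`. The sum `|N| + |P| - 1` is free of `t`, and `|P| ≤ ⌈|N|/2⌉`. -/
theorem exists_mem_share_inter_of_first (r p : Profile n m) {N : List (Fin n)}
    {A : Allocation n m} (hN : N.Nodup) (hA : {i | i ∈ N}.PairwiseDisjoint A) {i : Fin n}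
    (hi : i ∈ N) {K : Finset (Fin m)} (hK : ∀ x ∈ K, ∀ y, r i x ≤ r i y → y ∈ K)
    (hcard : N.length + (N.length + 1) / 2 ≤ (K ∩ pool A N).card + 1) :
    ∃ x ∈ share r p true N A i, x ∈ K := by
  by_cases hlen : 2 ≤ N.length
  · obtain ⟨P, Q, h, hiP⟩ := exists_isSplit_of_mem hi
    rw [share_eq_of_isSplit r p true h hN hlen hA hiP]
    by_cases hno : ∀ x ∈ allocateBest r P (pool (plant p N A) Q) i, x ∉ K
    · have h1 := card_inter_pool_le r p h hN hlen hA hiP hK true hno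
      have h2 := h.length_add
      have h3 := h.length_le
      have h4 := idxOf_reverse_add (h.nodup hN) hiP
      obtain ⟨x, hx, hxK⟩ := exists_mem_share_inter r p (nodup_ite_reverse true (h.nodup hN))
        (pairwiseDisjoint_leftover r h (pairwiseDisjoint_plant p hN hlen hA) true)
        ((mem_ite_reverse true P i).2 hiP) hK (by
          simp only [if_true, List.length_reverse] at h1 ⊢
          omega)
      exact ⟨x, Finset.mem_union_right _ hx, hxK⟩
    · push Not at hno
      obtain ⟨x, hx, hxK⟩ := hno
      exact ⟨x, Finset.mem_union_left _ hx, hxK⟩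
  · match N with
    | [] => simp at hi
    | [a] =>
      rw [List.mem_singleton] at hi
      subst hi
      have hpos : 0 < (K ∩ pool A [i]).card := by
        simp only [List.length_cons, List.length_nil] at hcard
        omega
      obtain ⟨x, hx⟩ := Finset.card_pos.1 hpos
      rw [Finset.mem_inter, mem_pool] at hx
      rw [share_singleton]
      exact ⟨x, by simpa using hx.2, hx.1⟩
    | _ :: _ :: _ => simp at hlen

/-! ### Picking sequences -/

/-- `B d i` is what `i` picks in round `d`, where round `0` has the order `N` and the later rounds
have the order `N'`: each agent strictly prefers its pick to every later one, and nothing is picked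
after an agent has found nothing. -/
structure IsPickingSequence (v : Profile n m) (N N' : List (Fin n)) (B : ℕ → Allocation n m) :
    Prop where
  card_le_one : ∀ d, ∀ i ∈ N, (B d i).card ≤ 1
  beats : ∀ d d', d < d' → ∀ i ∈ N, ∀ j ∈ N, ∀ x ∈ B d i, ∀ y ∈ B d' j, Beats (v i) x y
  empty : ∀ d d', d < d' → ∀ i ∈ N, ∀ j ∈ N, B d i = ∅ → B d' j = ∅
  zero : N.Pairwise (Precedes v (B 0))
  succ : ∀ d, N'.Pairwise (Precedes v (B (d + 1)))

namespace IsPickingSequence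

variable {v : Profile n m} {N N' : List (Fin n)} {B : ℕ → Allocation n m} {A : Allocation n m}

theorem disjoint_of_pairwise {R : Allocation n m} {L : List (Fin n)}
    (h : L.Pairwise (Precedes v R)) {i j : Fin n} (hi : i ∈ L) (hj : j ∈ L) (hij : i ≠ j) :
    Disjoint (R i) (R j) := by
  have hp : L.Pairwise fun i j => Disjoint (R i) (R j) :=
    h.imp fun {i j} hij => Finset.disjoint_left.2 fun x hx hx' => (hij.1 x hx x hx').ne rfl
  have : Std.Symm fun i j => Disjoint (R i) (R j) := ⟨fun _ _ h => h.symm⟩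
  exact hp.forall hi hj hij

theorem disjoint (h : IsPickingSequence v N N' B) (hN' : ∀ i ∈ N, i ∈ N') {i j : Fin n}
    (hi : i ∈ N) (hj : j ∈ N) {d d' : ℕ} (hne : d ≠ d' ∨ i ≠ j) : Disjoint (B d i) (B d' j) := by
  rcases lt_trichotomy d d' with hd | rfl | hd
  · exact Finset.disjoint_left.2 fun x hx hx' => (h.beats d d' hd i hi j hj x hx x hx').ne rfl
  · have hij : i ≠ j := hne.resolve_left fun h => h rfl
    cases d with
    | zero => exact disjoint_of_pairwise h.zero hi hj hij
    | succ d => exact disjoint_of_pairwise (h.succ d) (hN' i hi) (hN' j hj) hij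
  · exact Finset.disjoint_left.2 fun x hx hx' => (h.beats d' d hd j hj i hi x hx' x hx).ne rfl

theorem pairwiseDisjoint (h : IsPickingSequence v N N' B) (hN' : ∀ i ∈ N, i ∈ N')
    (hA : ∀ i ∈ N, ∀ x, x ∈ A i ↔ ∃ d, x ∈ B d i) : {i | i ∈ N}.PairwiseDisjoint A := by
  intro i hi j hj hij
  refine Finset.disjoint_left.2 fun x hxi hxj => ?_
  obtain ⟨d, hd⟩ := (hA i hi x).1 hxi
  obtain ⟨d', hd'⟩ := (hA j hj x).1 hxj
  exact Finset.disjoint_left.1 (h.disjoint hN' hi hj (Or.inr hij)) hd hd'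

/-- The first pick beats all later ones, and an empty first pick makes them empty. Hence the planted
items are exactly the picks of round `0`. -/
theorem favorite_eq (h : IsPickingSequence v N N' B) (hA : ∀ i ∈ N, ∀ x, x ∈ A i ↔ ∃ d, x ∈ B d i)
    {i : Fin n} (hi : i ∈ N) : favorite (v i) (A i) = B 0 i := by
  rcases (B 0 i).eq_empty_or_nonempty with h0 | ⟨x, hx⟩
  · rw [h0, favorite_eq_empty_iff, Finset.eq_empty_iff_forall_notMem]
    intro x hx
    obtain ⟨d, hd⟩ := (hA i hi x).1 hx
    rcases Nat.eq_zero_or_pos d with rfl | hpos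
    · simp [h0] at hd
    · simp [h.empty 0 d hpos i hi i hi h0] at hd
  · have hs : B 0 i = {x} := Finset.eq_singleton_iff_unique_mem.2
      ⟨hx, fun y hy => Finset.card_le_one.1 (h.card_le_one 0 i hi) y hy x hx⟩
    rw [hs]
    refine favorite_eq_singleton ((hA i hi x).2 ⟨0, hx⟩) fun y hy hne => ?_
    obtain ⟨d, hd⟩ := (hA i hi y).1 hy
    rcases Nat.eq_zero_or_pos d with rfl | hpos
    · rw [hs, Finset.mem_singleton] at hd
      exact absurd hd hne
    · exact h.beats 0 d hpos i hi i hi x hx y hd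

/-- Without round `0` all rounds have the order `N'`. This is why the recursion reverses its lists
once, after the first level, and never again. -/
theorem tail (h : IsPickingSequence v N N' B) {P' : List (Fin n)} (hP' : P'.Sublist N')
    (hP : ∀ i ∈ P', i ∈ N) : IsPickingSequence v P' P' fun d => B (d + 1) where
  card_le_one d i hi := h.card_le_one _ i (hP i hi)
  beats d d' hd i hi j hj := h.beats _ _ (by omega) i (hP i hi) j (hP j hj)
  empty d d' hd i hi j hj := h.empty _ _ (by omega) i (hP i hi) j (hP j hj)
  zero := (h.succ 0).sublist hP'
  succ d := (h.succ (d + 1)).sublist hP'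

/-- With correct predictions, all agents steal their planted favorite items back. -/
theorem allocateBest_pool_plant (h : IsPickingSequence v N N' B) (hN' : ∀ i ∈ N, i ∈ N')
    (hN : N.Nodup) (hlen : 2 ≤ N.length)
    (hA : ∀ i ∈ N, ∀ x, x ∈ A i ↔ ∃ d, x ∈ B d i) {P Q : List (Fin n)} (hs : IsSplit N P Q) :
    ∀ i ∈ P, allocateBest v P (pool (plant v N A) Q) i = B 0 i := by
  have hdisj := h.pairwiseDisjoint hN' hA
  obtain ⟨dest, hdest, hd⟩ := exists_isPlanting_plant v hN hlen hdisj
  have hPN : ∀ i ∈ P, i ∈ N := fun i hi => (hs.mem_iff i).2 (Or.inl hi)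
  have hQN : ∀ i ∈ Q, i ∈ N := fun i hi => (hs.mem_iff i).2 (Or.inr hi)
  -- The favorites of `Q` have been planted in `P`, so besides the favorites of `P` the pool of `Q`
  -- holds only picks of later rounds.
  have hlate : ∀ y ∈ pool (plant v N A) Q, y ∉ pool (B 0) P →
      ∃ d, ∃ j ∈ N, 0 < d ∧ y ∈ B d j := by
    intro y hy hyP
    obtain ⟨j, hj, hyj⟩ := mem_pool.1 hy
    rcases (hd j (hQN j hj) y).1 hyj with ⟨h1, h2⟩ | ⟨l, hl, hlj, h1⟩
    · obtain ⟨d, hyd⟩ := (hA j (hQN j hj) y).1 h1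
      rw [h.favorite_eq hA (hQN j hj)] at h2
      refine ⟨d, j, hQN j hj, Nat.pos_of_ne_zero ?_, hyd⟩
      rintro rfl
      exact h2 hyd
    · rw [h.favorite_eq hA hl] at h1
      rcases (hs.mem_iff l).1 hl with hlP | hlQ
      · exact absurd (mem_pool.2 ⟨l, hlP, h1⟩) hyP
      · have := hdest _ _ hs.symm l hlQ
        rw [hlj] at this
        exact absurd hj (hs.notMem hN this)
  refine allocateBest_eq_of_pairwise_precedes v (hs.nodup hN)
    (fun i hi => h.card_le_one 0 i (hPN i hi)) (h.zero.sublist hs.sublist) ?_ ?_ ?_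
  · intro x hx
    obtain ⟨i, hi, hxi⟩ := mem_pool.1 hx
    have hdi := hdest P Q hs i hi
    refine mem_pool.2 ⟨dest i, hdi, (hd _ (hQN _ hdi) x).2 (Or.inr ⟨i, hPN i hi, rfl, ?_⟩)⟩
    rwa [h.favorite_eq hA (hPN i hi)]
  · intro i hi x hx y hy
    obtain ⟨d, j, hj, hpos, hyj⟩ := hlate y (Finset.mem_sdiff.1 hy).1 (Finset.mem_sdiff.1 hy).2
    exact h.beats 0 d hpos i (hPN i hi) j hj x hx y hyj
  · intro i hi h0 y hy
    by_contra hyP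
    obtain ⟨d, j, hj, hpos, hyj⟩ := hlate y hy hyP
    simp [h.empty 0 d hpos i (hPN i hi) j hj h0] at hyj

/-- `P` has planted its own favorites in `Q`, and `Q` steals back those planted in `P`. Later picks
are worse than all first picks, hence distinct from them and untouched. -/
theorem mem_leftover_plant (h : IsPickingSequence v N N' B) (hN' : ∀ i ∈ N, i ∈ N')
    (hN : N.Nodup) (hlen : 2 ≤ N.length)
    (hA : ∀ i ∈ N, ∀ x, x ∈ A i ↔ ∃ d, x ∈ B d i) {P Q : List (Fin n)} (hs : IsSplit N P Q)
    {i : Fin n} (hi : i ∈ P) (x : Fin m) :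
    x ∈ leftover v P Q (plant v N A) i ↔ ∃ d, x ∈ B (d + 1) i := by
  have hdisj := h.pairwiseDisjoint hN' hA
  obtain ⟨dest, hdest, hd⟩ := exists_isPlanting_plant v hN hlen hdisj
  have hPN : ∀ i ∈ P, i ∈ N := fun i hi => (hs.mem_iff i).2 (Or.inl hi)
  have hQN : ∀ i ∈ Q, i ∈ N := fun i hi => (hs.mem_iff i).2 (Or.inr hi)
  rw [leftover, pool_congr (h.allocateBest_pool_plant hN' hN hlen hA hs.symm), Finset.mem_sdiff,
    hd i (hPN i hi) x, h.favorite_eq hA (hPN i hi)]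
  constructor
  · rintro ⟨⟨h1, h2⟩ | ⟨j, hj, hji, h1⟩, h3⟩
    · obtain ⟨d, hxd⟩ := (hA i (hPN i hi) x).1 h1
      cases d with
      | zero => exact absurd hxd h2
      | succ d => exact ⟨d, hxd⟩
    · rw [h.favorite_eq hA hj] at h1
      rcases (hs.mem_iff j).1 hj with hjP | hjQ
      · have := hdest P Q hs j hjP
        rw [hji] at this
        exact absurd this (hs.notMem hN hi)
      · exact absurd (mem_pool.2 ⟨j, hjQ, h1⟩) h3
  · rintro ⟨d, hxd⟩
    have hnot : ∀ j ∈ N, x ∉ B 0 j := fun j hj hxj =>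
      (h.beats 0 (d + 1) (by omega) j hj i (hPN i hi) x hxj x hxd).ne rfl
    refine ⟨Or.inl ⟨(hA i (hPN i hi) x).2 ⟨_, hxd⟩, hnot i (hPN i hi)⟩, fun hx => ?_⟩
    obtain ⟨j, hj, hxj⟩ := mem_pool.1 hx
    exact hnot j (hQN j hj) hxj

/-- With correct predictions, the recursion returns the tentative bundles. -/
theorem share_eq (first : Bool)
    (h : IsPickingSequence v N (if first then N.reverse else N) B) (hN : N.Nodup)
    (hA : ∀ i ∈ N, ∀ x, x ∈ A i ↔ ∃ d, x ∈ B d i) {i : Fin n} (hi : i ∈ N) :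
    share v v first N A i = A i := by
  have hdisj := h.pairwiseDisjoint (fun i => (mem_ite_reverse first N i).2) hA
  revert h hA hi B
  refine split_induction (motive := fun first N A => ∀ {B : ℕ → Allocation n m},
      IsPickingSequence v N (if first then N.reverse else N) B →
      (∀ i ∈ N, ∀ x, x ∈ A i ↔ ∃ d, x ∈ B d i) → i ∈ N → share v v first N A i = A i)
    v v ?_ ?_ ?_ first N A hN hdisj
  · simp
  · intro first a A B _ _ hi
    rw [List.mem_singleton] at hi
    subst hi
    exact share_singleton ..
  · intro first N A hN hlen hdisj ih B h hA hi
    have hN' : ∀ i ∈ N, i ∈ (if first then N.reverse else N) :=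
      fun i => (mem_ite_reverse first N i).2
    obtain ⟨P, Q, hs, hiP⟩ := exists_isSplit_of_mem hi
    have hsub : (if first then P.reverse else P).Sublist (if first then N.reverse else N) := by
      split
      · exact hs.sublist.reverse
      · exact hs.sublist
    rw [share_eq_of_isSplit v v first hs hN hlen hdisj hiP,
      h.allocateBest_pool_plant hN' hN hlen hA hs i hiP,
      ih P Q hs (B := fun d => B (d + 1)) ?_ ?_ ((mem_ite_reverse _ _ _).2 hiP)]
    · ext x
      rw [Finset.mem_union, h.mem_leftover_plant hN' hN hlen hA hs hiP, hA i hi]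
      constructor
      · rintro (hx | ⟨d, hx⟩)
        · exact ⟨0, hx⟩
        · exact ⟨d + 1, hx⟩
      · rintro ⟨d, hx⟩
        cases d with
        | zero => exact Or.inl hx
        | succ d => exact Or.inr ⟨d, hx⟩
    · simp only [Bool.false_eq_true, if_false]
      exact h.tail hsub fun j hj => hs.sublist.subset ((mem_ite_reverse _ _ _).1 hj)
    · intro j hj x
      exact h.mem_leftover_plant hN' hN hlen hA hs ((mem_ite_reverse _ _ _).1 hj) x

end IsPickingSequence

/-! ### The tentative allocation -/

/-- The order of the agents in round `d`, counted from `0`, of the tentative allocation. -/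
def roundOrder (N : List (Fin n)) : ℕ → List (Fin n)
  | 0 => N
  | _ + 1 => N.reverse

/-- The items remaining before round `d`, counted from `0`, of the tentative allocation. -/
noncomputable def remaining (p : Profile n m) (N : List (Fin n)) (M : Finset (Fin m)) :
    ℕ → Finset (Fin m)
  | 0 => M
  | d + 1 => remaining p N M d \
      pool (allocateBest p (roundOrder N d) (remaining p N M d)) (roundOrder N d)

/-- The picks in round `d`, counted from `0`, of the tentative allocation. -/
noncomputable def roundPicks (p : Profile n m) (N : List (Fin n)) (M : Finset (Fin m)) (d : ℕ) :
    Allocation n m :=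
  allocateBest p (roundOrder N d) (remaining p N M d)

theorem mem_roundOrder {N : List (Fin n)} {d : ℕ} {i : Fin n} : i ∈ roundOrder N d ↔ i ∈ N := by
  cases d <;> simp [roundOrder]

theorem nodup_roundOrder {N : List (Fin n)} (hN : N.Nodup) (d : ℕ) : (roundOrder N d).Nodup := by
  cases d <;> simpa [roundOrder] using hN

theorem length_roundOrder (N : List (Fin n)) (d : ℕ) : (roundOrder N d).length = N.length := by
  cases d <;> simp [roundOrder]

theorem remaining_succ (p : Profile n m) (N : List (Fin n)) (M : Finset (Fin m)) (d : ℕ) :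
    remaining p N M (d + 1) =
      remaining p N M d \ pool (roundPicks p N M d) (roundOrder N d) := rfl

theorem antitone_remaining (p : Profile n m) (N : List (Fin n)) (M : Finset (Fin m)) :
    Antitone (remaining p N M) :=
  antitone_nat_of_succ_le fun d => by
    rw [remaining_succ]
    exact Finset.sdiff_subset

theorem card_remaining (p : Profile n m) {N : List (Fin n)} (hN : N.Nodup)
    (M : Finset (Fin m)) (d : ℕ) : (remaining p N M d).card = M.card - d * N.length := by
  induction d with
  | zero => simp [remaining]
  | succ d ih =>
    rw [remaining, card_sdiff_pool_allocateBest p (nodup_roundOrder hN d), ih, length_roundOrder,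
      Nat.succ_mul, Nat.sub_sub]

/-- A pick of a later round was still unpicked at the end of round `d`, so whoever picked in round
`d` preferred its own item, whatever the order. -/
theorem isPickingSequence_roundPicks (p : Profile n m) {N : List (Fin n)} (hN : N.Nodup)
    (M : Finset (Fin m)) : IsPickingSequence p N N.reverse (roundPicks p N M) where
  card_le_one d i _ := card_allocateBest_le_one _ _ _ _
  beats d d' hd i _ j _ x hx y hy :=
    beats_of_mem_allocateBest p (nodup_roundOrder hN d) _ hx
      (antitone_remaining p N M (Nat.succ_le_of_lt hd) (allocateBest_subset _ _ _ _ hy))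
  empty d d' hd i hi j _ h := by
    have h1 := sdiff_pool_eq_empty_of_allocateBest_eq_empty p (nodup_roundOrder hN d) _
      (mem_roundOrder.2 hi) h
    have h2 := antitone_remaining p N M (Nat.succ_le_of_lt hd)
    rw [Nat.succ_eq_add_one, remaining, h1] at h2
    exact Finset.subset_empty.1 ((allocateBest_subset _ _ _ _).trans h2)
  zero := pairwise_precedes_allocateBest p hN M
  succ d := pairwise_precedes_allocateBest p (nodup_roundOrder hN (d + 1)) _

theorem moreRounds_remaining (p : Profile n m) (N : List (Fin n)) (M : Finset (Fin m)) (k d : ℕ)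
    (A : Allocation n m) (i : Fin n) :
    moreRounds p N.reverse k (remaining p N M (d + 1)) A i =
      A i ∪ (Finset.range k).biUnion fun e => roundPicks p N M (d + 1 + e) i := by
  induction k generalizing d A with
  | zero => simp [moreRounds]
  | succ k ih =>
    have h : remaining p N M (d + 1) \ pool (allocateBest p N.reverse (remaining p N M (d + 1)))
        N.reverse = remaining p N M (d + 1 + 1) := rfl
    rw [moreRounds, h, ih]
    ext x
    simp only [Finset.mem_union, Finset.mem_biUnion, Finset.mem_range, or_assoc]
    refine or_congr_right ?_
    constructor
    · rintro (hx | ⟨e, he, hx⟩)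
      · exact ⟨0, by omega, hx⟩
      · exact ⟨e + 1, by omega, by rwa [show d + 1 + (e + 1) = d + 1 + 1 + e by omega]⟩
    · rintro ⟨e, he, hx⟩
      cases e with
      | zero => exact Or.inl hx
      | succ e =>
        exact Or.inr ⟨e, by omega, by rwa [show d + 1 + 1 + e = d + 1 + (e + 1) by omega]⟩

/-- The number of rounds of the tentative allocation. -/
def numRounds (N : List (Fin n)) (M : Finset (Fin m)) : ℕ :=
  ⌈(M.card : ℚ) / (N.length : ℚ)⌉₊ - 1 + 1

theorem tentative_eq (p : Profile n m) (N : List (Fin n)) (M : Finset (Fin m)) (i : Fin n) :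
    tentative p N M i =
      (Finset.range (numRounds N M)).biUnion fun d => roundPicks p N M d i := by
  have h := moreRounds_remaining p N M (⌈(M.card : ℚ) / (N.length : ℚ)⌉₊ - 1) 0
    (allocateBest p N M) i
  refine h.trans ?_
  ext x
  simp only [Finset.mem_union, Finset.mem_biUnion, Finset.mem_range, numRounds]
  constructor
  · rintro (hx | ⟨e, he, hx⟩)
    · exact ⟨0, by omega, hx⟩
    · exact ⟨0 + 1 + e, by omega, hx⟩
  · rintro ⟨e, he, hx⟩
    cases e with
    | zero => exact Or.inl hx
    | succ e => exact Or.inr ⟨e, by omega, by rwa [show 0 + 1 + e = e + 1 by omega]⟩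

/-- The ceiling gives `|M| ≤ numRounds N M * |N|`, and each round removes `|N|` items as long as
they last. -/
theorem remaining_numRounds (p : Profile n m) {N : List (Fin n)} (hN : N.Nodup) (hne : N ≠ [])
    (M : Finset (Fin m)) : remaining p N M (numRounds N M) = ∅ := by
  rw [← Finset.card_eq_zero, card_remaining p hN]
  have hpos : (0 : ℚ) < N.length := by
    exact_mod_cast List.length_pos_of_ne_nil hne
  have h1 : (M.card : ℚ) ≤ (numRounds N M : ℚ) * N.length := by
    rw [← div_le_iff₀ hpos]
    refine (Nat.le_ceil _).trans ?_
    unfold numRounds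
    exact_mod_cast (by omega)
  have h2 : M.card ≤ numRounds N M * N.length := by exact_mod_cast h1
  omega

/-- `roundPicks` runs on forever, but after `numRounds` rounds no item is left to pick. -/
theorem mem_tentative (p : Profile n m) {N : List (Fin n)} (hN : N.Nodup) (hne : N ≠ [])
    (M : Finset (Fin m)) (i : Fin n) (x : Fin m) :
    x ∈ tentative p N M i ↔ ∃ d, x ∈ roundPicks p N M d i := by
  rw [tentative_eq]
  simp only [Finset.mem_biUnion, Finset.mem_range]
  constructor
  · rintro ⟨d, -, hx⟩
    exact ⟨d, hx⟩
  · rintro ⟨d, hx⟩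
    refine ⟨d, ?_, hx⟩
    by_contra hd
    have := antitone_remaining p N M (not_lt.1 hd) (allocateBest_subset _ _ _ _ hx)
    simp [remaining_numRounds p hN hne] at this

theorem pairwiseDisjoint_tentative (p : Profile n m) {N : List (Fin n)} (hN : N.Nodup)
    (M : Finset (Fin m)) : {i | i ∈ N}.PairwiseDisjoint (tentative p N M) := by
  intro i hi
  exact (isPickingSequence_roundPicks p hN M).pairwiseDisjoint (fun i => List.mem_reverse.2)
    (fun i _ x => mem_tentative p hN (List.ne_nil_of_mem hi) M i x) hi

theorem pool_tentative (p : Profile n m) {N : List (Fin n)} (hN : N.Nodup) (hne : N ≠ [])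
    (M : Finset (Fin m)) : pool (tentative p N M) N = M := by
  have key : ∀ d, ∀ x ∈ M, x ∉ remaining p N M d → ∃ e, ∃ i ∈ N, x ∈ roundPicks p N M e i := by
    intro d
    induction d with
    | zero => exact fun x hx h => absurd hx h
    | succ d ih =>
      intro x hx h
      by_cases hd : x ∈ remaining p N M d
      · rw [remaining_succ, Finset.mem_sdiff, not_and, not_not] at h
        obtain ⟨i, hi, hxi⟩ := mem_pool.1 (h hd)
        exact ⟨d, i, mem_roundOrder.1 hi, hxi⟩
      · exact ih x hx hd
  ext x
  simp only [mem_pool, mem_tentative p hN hne]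
  constructor
  · rintro ⟨i, -, d, hx⟩
    exact antitone_remaining p N M (Nat.zero_le d) (allocateBest_subset _ _ _ _ hx)
  · intro hx
    obtain ⟨e, i, hi, hxi⟩ := key (numRounds N M) x hx (by simp [remaining_numRounds p hN hne])
    exact ⟨i, hi, e, hxi⟩

theorem share_tentative (v : Profile n m) {N : List (Fin n)} (hN : N.Nodup)
    (M : Finset (Fin m)) {i : Fin n} (hi : i ∈ N) :
    share v v true N (tentative v N M) i = tentative v N M i :=
  IsPickingSequence.share_eq true (B := roundPicks v N M)
    (by simpa using isPickingSequence_roundPicks v hN M) hN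
    (fun i _ x => mem_tentative v hN (List.ne_nil_of_mem hi) M i x) hi

theorem value_le_of_card_le_one {v : Valuation m} {S : Finset (Fin m)} {c : ℝ≥0}
    (hS : S.card ≤ 1) (hc : ∀ x ∈ S, v x ≤ c) : value v S ≤ c := by
  refine (Finset.sum_le_card_nsmul _ _ _ hc).trans ?_
  calc S.card • c ≤ 1 • c := nsmul_le_nsmul_left zero_le hS
    _ = c := one_nsmul c

/-- Up to one item, no agent envies another for its tentative bundle. -/
theorem value_tentative_le (p : Profile n m) {N : List (Fin n)} (hN : N.Nodup)
    {M : Finset (Fin m)} {i j : Fin n} (hi : i ∈ N) (hj : j ∈ N) {c : ℝ≥0}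
    (hc : ∀ x ∈ M, p i x ≤ c) :
    value (p i) (tentative p N M j) ≤ value (p i) (tentative p N M i) + c := by
  have hseq := isPickingSequence_roundPicks p hN M
  -- Comparing round `d + 1` of `j` with round `d` of `i` leaves only the first pick of `j`, which
  -- costs at most `c`.
  have hstep : ∀ d, value (p i) (roundPicks p N M (d + 1) j) ≤
      value (p i) (roundPicks p N M d i) := by
    intro d
    refine value_le_of_card_le_one (hseq.card_le_one _ j hj) fun y hy => ?_
    rcases (roundPicks p N M d i).eq_empty_or_nonempty with h | ⟨x, hx⟩
    · simp [hseq.empty d (d + 1) (by omega) i hi j hj h] at hy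
    · exact (hseq.beats d (d + 1) (by omega) i hi j hj x hx y hy).le.trans (le_value_of_mem _ hx)
  have hsum : ∀ l ∈ N, value (p i) (tentative p N M l) =
      ∑ d ∈ Finset.range (numRounds N M), value (p i) (roundPicks p N M d l) := by
    intro l hl
    rw [tentative_eq]
    exact Finset.sum_biUnion fun d _ d' _ hd =>
      hseq.disjoint (fun i => List.mem_reverse.2) hl hl (Or.inl hd)
  rw [hsum i hi, hsum j hj, numRounds, Finset.sum_range_succ', Finset.sum_range_succ]
  refine add_le_add ((Finset.sum_le_sum fun d _ => hstep d).trans (le_add_of_nonneg_right zero_le))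
    (value_le_of_card_le_one (hseq.card_le_one 0 j hj) fun x hx => hc x ?_)
  exact allocateBest_subset _ _ _ _ hx

/-! ### The allocation of large items -/

/-- Who is served depends only on the prediction and the remaining items, so the alternative is
uniform in `r` and `X`. This makes runs with different reports comparable. -/
theorem allocateLarge_cases (p : Profile n m) (N : List (Fin n)) (M : Finset (Fin m)) :
    ((∀ i ∈ N, ¬ isLarge p M i) ∧ ∀ r X, allocateLarge r p N M X = ⟨N, M, X⟩) ∨
    ∃ i ∈ N, isLarge p M i ∧ ∀ r X, allocateLarge r p N M X =
      allocateLarge r p (N.erase i) (M \ favorite (r i) M)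
        (Function.update X i (favorite (r i) M)) := by
  classical
  rcases h : N.find? (fun i => decide (isLarge p M i)) with _ | i
  · refine Or.inl ⟨by simpa using h, fun r X => ?_⟩
    rw [allocateLarge]
    split
    · rfl
    · rename_i i hi
      simp_all
  · refine Or.inr ⟨i, List.mem_of_find?_eq_some h, by simpa using List.find?_some h,
      fun r X => ?_⟩
    rw [allocateLarge]
    split
    · simp_all
    · rename_i j hj
      have : j = i := by simp_all
      subst this
      rfl

/-- What the allocation of large items does to the agents `N`, the items `M` and the bundles `X`. -/
structure LargeSpec (r p : Profile n m) (N : List (Fin n)) (M : Finset (Fin m))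
    (X : Allocation n m) (s : State n m) : Prop where
  sublist : s.agents.Sublist N
  items_subset : s.items ⊆ M
  card_add_length_le : (M \ s.items).card + s.agents.length ≤ N.length
  alloc_of_notMem : ∀ i, i ∉ N → s.alloc i = X i
  alloc_of_mem : ∀ i ∈ s.agents, s.alloc i = X i
  not_isLarge : ∀ i ∈ s.agents, ¬ isLarge p s.items i
  alloc_eq_favorite : ∀ i ∈ N, i ∉ s.agents → ∃ R ⊆ M, (M \ R).card < N.length ∧
    isLarge p R i ∧ s.alloc i = favorite (r i) R
  alloc_subset : ∀ i ∈ N, i ∉ s.agents → s.alloc i ⊆ M \ s.items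
  disjoint : ∀ i ∈ N, i ∉ s.agents → ∀ j ∈ N, j ∉ s.agents → i ≠ j →
    Disjoint (s.alloc i) (s.alloc j)
  exists_mem : ∀ x ∈ M, x ∉ s.items → ∃ i ∈ N, i ∉ s.agents ∧ x ∈ s.alloc i

/-- Serving `a` removes one agent and at most one item, and the bundle of `a` is final because `a`
has left the list. -/
theorem largeSpec_allocateLarge (r p : Profile n m) {N : List (Fin n)} (hN : N.Nodup)
    (M : Finset (Fin m)) (X : Allocation n m) :
    LargeSpec r p N M X (allocateLarge r p N M X) := by
  induction hl : N.length generalizing N M X with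
  | zero =>
    rw [List.length_eq_zero_iff] at hl
    subst hl
    rcases allocateLarge_cases p [] M with ⟨-, h⟩ | ⟨i, hi, -⟩
    · rw [h]
      constructor <;> simp
    · simp at hi
  | succ l ih =>
    rcases allocateLarge_cases p N M with ⟨h, heq⟩ | ⟨a, ha, hlarge, heq⟩
    · rw [heq]
      constructor <;> simp_all
    · rw [heq]
      have hlen := List.length_erase_of_mem ha
      have hs := ih (hN.erase a) (M \ favorite (r a) M) (Function.update X a (favorite (r a) M))
        (by omega)
      set s := allocateLarge r p (N.erase a) (M \ favorite (r a) M)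
        (Function.update X a (favorite (r a) M))
      have haE : a ∉ N.erase a := hN.not_mem_erase
      have hmem : ∀ i ∈ N, i ≠ a → i ∈ N.erase a := fun i hi hia =>
        (List.mem_erase_of_ne hia).2 hi
      have haS : a ∉ s.agents := fun h => haE (hs.sublist.subset h)
      have hsa : s.alloc a = favorite (r a) M := by
        rw [hs.alloc_of_notMem a haE, Function.update_self]
      have hfa := card_favorite_le_one (r a) M
      have hcard : ∀ R : Finset (Fin m),
          (M \ R).card ≤ ((M \ favorite (r a) M) \ R).card + 1 := by
        intro R
        have hsub : M \ R ⊆ ((M \ favorite (r a) M) \ R) ∪ favorite (r a) M := by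
          intro x hx
          simp only [Finset.mem_sdiff, Finset.mem_union] at hx ⊢
          tauto
        have := (Finset.card_le_card hsub).trans (Finset.card_union_le _ _)
        omega
      have hdisj : ∀ j ∈ N, j ≠ a → j ∉ s.agents → Disjoint (s.alloc a) (s.alloc j) := by
        intro j hj hja hjs
        rw [hsa]
        exact Finset.disjoint_sdiff.mono_right
          ((hs.alloc_subset j (hmem j hj hja) hjs).trans Finset.sdiff_subset)
      constructor
      · exact hs.sublist.trans List.erase_sublist
      · exact hs.items_subset.trans Finset.sdiff_subset
      · have := hs.card_add_length_le
        have := hcard s.items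
        omega
      · intro i hi
        rw [hs.alloc_of_notMem i fun h => hi (List.mem_of_mem_erase h),
          Function.update_of_ne fun h : i = a => hi (h ▸ ha)]
      · intro i hi
        rw [hs.alloc_of_mem i hi, Function.update_of_ne fun h : i = a => haS (h ▸ hi)]
      · exact hs.not_isLarge
      · intro i hi his
        by_cases hia : i = a
        · subst hia
          exact ⟨M, subset_rfl, by simp [hl], hlarge, hsa⟩
        · obtain ⟨R, hR, hRc, hRl, hRe⟩ := hs.alloc_eq_favorite i (hmem i hi hia) his
          refine ⟨R, hR.trans Finset.sdiff_subset, ?_, hRl, hRe⟩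
          have := hcard R
          omega
      · intro i hi his
        by_cases hia : i = a
        · subst hia
          rw [hsa]
          intro x hx
          refine Finset.mem_sdiff.2 ⟨favorite_subset _ _ hx, fun hxs => ?_⟩
          exact (Finset.mem_sdiff.1 (hs.items_subset hxs)).2 hx
        · exact (hs.alloc_subset i (hmem i hi hia) his).trans
            (Finset.sdiff_subset_sdiff Finset.sdiff_subset subset_rfl)
      · intro i hi his j hj hjs hij
        by_cases hia : i = a
        · subst hia
          exact hdisj j hj (Ne.symm hij) hjs
        · by_cases hja : j = a
          · subst hja
            exact (hdisj i hi hia his).symm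
          · exact hs.disjoint i (hmem i hi hia) his j (hmem j hj hja) hjs hij
      · intro x hx hxs
        by_cases hxa : x ∈ favorite (r a) M
        · exact ⟨a, ha, haS, hsa ▸ hxa⟩
        · obtain ⟨i, hi, h⟩ := hs.exists_mem x (Finset.mem_sdiff.2 ⟨hx, hxa⟩) hxs
          exact ⟨i, List.mem_of_mem_erase hi, h⟩

/-- Whether agent `i` gets a large item does not depend on its report, and if it does then the
report only serves to choose its favorite item of a set that does not depend on the report. -/
theorem allocateLarge_update (r p : Profile n m) {N : List (Fin n)} (hN : N.Nodup)
    (M : Finset (Fin m)) (X : Allocation n m) {i : Fin n} (hi : i ∈ N) :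
    (∃ s : State n m, i ∈ s.agents ∧
      ∀ u, allocateLarge (Function.update r i u) p N M X = s) ∨
    ∃ R, ∀ u, i ∉ (allocateLarge (Function.update r i u) p N M X).agents ∧
      (allocateLarge (Function.update r i u) p N M X).alloc i = favorite u R := by
  induction hl : N.length generalizing N M X with
  | zero =>
    rw [List.length_eq_zero_iff] at hl
    simp [hl] at hi
  | succ l ih =>
    rcases allocateLarge_cases p N M with ⟨h, heq⟩ | ⟨a, ha, hlarge, heq⟩
    · exact Or.inl ⟨⟨N, M, X⟩, hi, fun u => heq _ _⟩
    · by_cases hia : i = a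
      · subst hia
        -- The report of `i` is unused until `i` is served, so the current `M` is the same for all
        -- `u`.
        refine Or.inr ⟨M, fun u => ?_⟩
        have hs := largeSpec_allocateLarge (Function.update r i u) p (hN.erase i)
          (M \ favorite u M) (Function.update X i (favorite u M))
        have hiE : i ∉ N.erase i := hN.not_mem_erase
        rw [heq, Function.update_self]
        exact ⟨fun h => hiE (hs.sublist.subset h), by
          rw [hs.alloc_of_notMem i hiE, Function.update_self]⟩
      · have hlen := List.length_erase_of_mem ha
        simp only [heq, Function.update_of_ne (Ne.symm hia)]
        exact ih (hN.erase a) _ _ ((List.mem_erase_of_ne hia).2 hi) (by omega)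

theorem largeSpec_afterLarge (r p : Profile n m) :
    LargeSpec r p (List.finRange n) Finset.univ (fun _ => ∅) (afterLarge r p) :=
  largeSpec_allocateLarge r p (List.nodup_finRange n) _ _

theorem nodup_agents_afterLarge (r p : Profile n m) : (afterLarge r p).agents.Nodup :=
  (List.nodup_finRange n).sublist (largeSpec_afterLarge r p).sublist

/-! ### The mechanism -/

theorem nAgentMechanism_eq (r p : Profile n m) (i : Fin n) :
    nAgentMechanism n m r p i = (afterLarge r p).alloc i ∪
      share r p true (afterLarge r p).agents
        (tentative p (afterLarge r p).agents (afterLarge r p).items) i :=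
  splitPlantSteal_eq_union_share _ _ _ _ _ _ _

theorem nAgentMechanism_of_notMem (r p : Profile n m) {i : Fin n}
    (hi : i ∉ (afterLarge r p).agents) :
    nAgentMechanism n m r p i = (afterLarge r p).alloc i := by
  rw [nAgentMechanism_eq, share_of_notMem _ _ _ _ hi, Finset.union_empty]

theorem nAgentMechanism_of_mem (r p : Profile n m) {i : Fin n}
    (hi : i ∈ (afterLarge r p).agents) :
    nAgentMechanism n m r p i = share r p true (afterLarge r p).agents
        (tentative p (afterLarge r p).agents (afterLarge r p).items) i := by
  rw [nAgentMechanism_eq, (largeSpec_afterLarge r p).alloc_of_mem i hi, Finset.empty_union]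

theorem share_tentative_subset (r p : Profile n m) {N : List (Fin n)} (hN : N.Nodup)
    (M : Finset (Fin m)) {i : Fin n} (hi : i ∈ N) :
    share r p true N (tentative p N M) i ⊆ M := by
  have := share_subset_pool r p true hN (pairwiseDisjoint_tentative p hN M) i
  rwa [pool_tentative p hN (List.ne_nil_of_mem hi)] at this

theorem disjoint_nAgentMechanism (r p : Profile n m) {i j : Fin n} (hij : i ≠ j) :
    Disjoint (nAgentMechanism n m r p i) (nAgentMechanism n m r p j) := by
  have hs := largeSpec_afterLarge r p
  have hN := nodup_agents_afterLarge r p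
  have key : ∀ i j, i ∉ (afterLarge r p).agents → j ∈ (afterLarge r p).agents →
      Disjoint (nAgentMechanism n m r p i) (nAgentMechanism n m r p j) := by
    intro i j hi hj
    rw [nAgentMechanism_of_notMem r p hi, nAgentMechanism_of_mem r p hj]
    exact Finset.sdiff_disjoint.mono (hs.alloc_subset i (List.mem_finRange i) hi)
      (share_tentative_subset r p hN _ hj)
  by_cases hi : i ∈ (afterLarge r p).agents <;> by_cases hj : j ∈ (afterLarge r p).agents
  · rw [nAgentMechanism_of_mem r p hi, nAgentMechanism_of_mem r p hj]
    exact pairwiseDisjoint_share r p true hN (pairwiseDisjoint_tentative p hN _) hi hj hij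
  · exact (key j i hj hi).symm
  · exact key i j hi hj
  · rw [nAgentMechanism_of_notMem r p hi, nAgentMechanism_of_notMem r p hj]
    exact hs.disjoint i (List.mem_finRange i) hi j (List.mem_finRange j) hj hij

theorem exists_mem_nAgentMechanism (r p : Profile n m) (hne : (afterLarge r p).agents ≠ [])
    (x : Fin m) : ∃ i, x ∈ nAgentMechanism n m r p i := by
  have hN := nodup_agents_afterLarge r p
  by_cases hx : x ∈ (afterLarge r p).items
  · rw [← pool_tentative p hN hne (afterLarge r p).items] at hx
    obtain ⟨i, hi, hxi⟩ :=
      exists_mem_share r p true hN (pairwiseDisjoint_tentative p hN _) hx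
    exact ⟨i, by rwa [nAgentMechanism_of_mem r p hi]⟩
  · obtain ⟨i, -, hi, hxi⟩ := (largeSpec_afterLarge r p).exists_mem x (Finset.mem_univ x) hx
    exact ⟨i, by rwa [nAgentMechanism_of_notMem r p hi]⟩

/-- Either `i` survives the large items with a state that ignores its report, and the recursion
decides, or it chooses one item from a fixed set. -/
theorem truthful_nAgentMechanism (n m : ℕ) : Truthful (nAgentMechanism n m) := by
  intro i u r p
  rcases allocateLarge_update r p (List.nodup_finRange n) Finset.univ (fun _ => ∅)
    (List.mem_finRange i) with ⟨s, hi, hs⟩ | ⟨R, hR⟩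
  · have h1 : afterLarge r p = s := by simpa [afterLarge] using hs (r i)
    have h2 : afterLarge (Function.update r i u) p = s := hs u
    have hN := nodup_agents_afterLarge r p
    rw [nAgentMechanism_of_mem r p (h1 ▸ hi),
      nAgentMechanism_of_mem _ p (h2 ▸ hi : i ∈ (afterLarge (Function.update r i u) p).agents)]
    rw [h1] at hN
    rw [h1, h2]
    exact value_share_le_of_update r p true hN (pairwiseDisjoint_tentative p hN _) hi u
  · have h1 : i ∉ (afterLarge r p).agents ∧ (afterLarge r p).alloc i = favorite (r i) R := by
      simpa [afterLarge] using hR (r i)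
    have h2 : i ∉ (afterLarge (Function.update r i u) p).agents ∧
        (afterLarge (Function.update r i u) p).alloc i = favorite u R := hR u
    rw [nAgentMechanism_of_notMem r p h1.1, nAgentMechanism_of_notMem _ p h2.1, h1.2, h2.2]
    exact value_favorite_le _ _ _

/-- Every agent gets an item of each sufficiently large set that is upward closed for it. -/
theorem exists_mem_nAgentMechanism_inter (v p : Profile n m) (i : Fin n) {K : Finset (Fin m)}
    (hK : ∀ x ∈ K, ∀ y, v i x ≤ v i y → y ∈ K) (hcard : n + (n + 1) / 2 ≤ K.card + 1) :
    ∃ x ∈ nAgentMechanism n m v p i, x ∈ K := by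
  have hs := largeSpec_afterLarge v p
  have hn : 0 < n := i.pos
  have hcomp : ∀ R : Finset (Fin m), K.card ≤ (K ∩ R).card + (Finset.univ \ R).card := by
    intro R
    rw [← Finset.card_inter_add_card_sdiff K R]
    exact Nat.add_le_add_left
      (Finset.card_le_card (Finset.sdiff_subset_sdiff (Finset.subset_univ _) subset_rfl)) _
  by_cases hi : i ∈ (afterLarge v p).agents
  · have hN := nodup_agents_afterLarge v p
    rw [nAgentMechanism_of_mem v p hi]
    refine exists_mem_share_inter_of_first v p hN (pairwiseDisjoint_tentative p hN _) hi hK ?_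
    rw [pool_tentative p hN (List.ne_nil_of_mem hi)]
    -- Each removed item of `K` is paid for by a departed agent, so the bound passes from `n` to the
    -- remaining agents.
    have h1 := hs.card_add_length_le
    have h2 := hcomp (afterLarge v p).items
    rw [List.length_finRange] at h1
    omega
  -- Fewer than `n` items are gone when `i` is served, while `K` has at least `n`.
  · obtain ⟨R, -, hRc, -, hR⟩ := hs.alloc_eq_favorite i (List.mem_finRange i) hi
    rw [List.length_finRange] at hRc
    have h2 := hcomp R
    have hpos : 0 < (K ∩ R).card := by omega
    obtain ⟨x, hx⟩ := Finset.card_pos.1 hpos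
    rw [Finset.mem_inter] at hx
    obtain ⟨y, hy, hyf, -⟩ := exists_favorite (v i) ⟨x, hx.2⟩
    have hyf' : y ∈ favorite (v i) R := by simp [hyf]
    rw [nAgentMechanism_of_notMem v p hi, hR]
    exact ⟨y, hyf', hK x hx.1 y (le_of_mem_favorite hyf' hx.2)⟩

/-! ### Maximin shares and order statistics -/

theorem exists_mms_le_value (v : Valuation m) {k : ℕ} (hk : 0 < k) :
    ∃ f : Fin m → Fin k, ∀ b, mms v k ≤ value v (Finset.univ.filter fun j => f j = b) := by
  have : Nonempty (Fin k) := ⟨⟨0, hk⟩⟩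
  obtain ⟨f, hf⟩ := exists_eq_ciSup_of_finite
    (f := fun f : Fin m → Fin k => ⨅ b : Fin k, value v (Finset.univ.filter fun j => f j = b))
  refine ⟨f, fun b => ?_⟩
  rw [mms, ← hf]
  exact ciInf_le (OrderBot.bddBelow _) b

/-- Removing `c` items leaves at least `k - c` bundles of an optimal partition untouched. -/
theorem sub_mul_mms_le_value (v : Valuation m) {k : ℕ} (hk : 0 < k) (M : Finset (Fin m)) :
    ((k - (Finset.univ \ M).card : ℕ) : ℝ≥0) * mms v k ≤ value v M := by
  obtain ⟨f, hf⟩ := exists_mms_le_value v hk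
  -- The indices of the bundles that lose no item.
  set U := Finset.univ \ (Finset.univ \ M).image f with hU
  have hUM : ∀ b ∈ U, (Finset.univ.filter fun j => f j = b) = M.filter fun j => f j = b := by
    intro b hb
    ext j
    simp only [hU, Finset.mem_sdiff, Finset.mem_image, Finset.mem_univ, true_and, not_exists,
      not_and, Finset.mem_filter] at hb ⊢
    refine ⟨fun h => ⟨?_, h⟩, fun h => h.2⟩
    by_contra hj
    exact hb j hj h
  have hcard : k - (Finset.univ \ M).card ≤ U.card := by
    have h1 := Finset.le_card_sdiff ((Finset.univ \ M).image f) (Finset.univ : Finset (Fin k))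
    have h2 := Finset.card_image_le (s := Finset.univ \ M) (f := f)
    rw [Finset.card_univ, Fintype.card_fin, ← hU] at h1
    omega
  calc ((k - (Finset.univ \ M).card : ℕ) : ℝ≥0) * mms v k
      ≤ (U.card : ℝ≥0) * mms v k := by gcongr
    _ = ∑ _b ∈ U, mms v k := by simp
    _ ≤ ∑ b ∈ U, value v (M.filter fun j => f j = b) :=
        Finset.sum_le_sum fun b hb => hUM b hb ▸ hf b
    _ ≤ ∑ b, value v (M.filter fun j => f j = b) :=
        Finset.sum_le_sum_of_subset (Finset.subset_univ U)
    _ = value v M := Finset.sum_fiberwise M f v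

/-- If all but `k - 2` items are worth at most `w`, then two of `k` bundles consist of such items
only, and the smaller one bounds the maximin share. -/
theorem mms_le_mul_of_card_add_two (v : Valuation m) {k : ℕ} {H : Finset (Fin m)}
    (hH : H.card + 2 = k) {w : ℝ≥0} (hw : ∀ j ∉ H, v j ≤ w) :
    mms v k ≤ (((m + 2 - k) / 2 : ℕ) : ℝ≥0) * w := by
  obtain ⟨f, hf⟩ := exists_mms_le_value v (by omega : 0 < k)
  -- `H` meets at most `k - 2` bundles, so two of them avoid it and share the other `m - (k - 2)`
  -- items.
  have h1 := Finset.le_card_sdiff (H.image f) (Finset.univ : Finset (Fin k))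
  have h2 := Finset.card_image_le (s := H) (f := f)
  rw [Finset.card_univ, Fintype.card_fin] at h1
  obtain ⟨b, hb, c, hc, hbc⟩ := Finset.one_lt_card.1
    (show 1 < (Finset.univ \ H.image f).card by omega)
  have hsub : ∀ a ∈ Finset.univ \ H.image f,
      (Finset.univ.filter fun j => f j = a) ⊆ Finset.univ \ H := by
    intro a ha j hj
    simp only [Finset.mem_sdiff, Finset.mem_univ, true_and, Finset.mem_image, not_exists, not_and,
      Finset.mem_filter] at ha hj ⊢
    exact fun hjH => ha j hjH hj
  have hdisj : Disjoint (Finset.univ.filter fun j => f j = b)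
      (Finset.univ.filter fun j => f j = c) := by
    refine Finset.disjoint_left.2 fun j hj hj' => hbc ?_
    rw [Finset.mem_filter] at hj hj'
    exact hj.2.symm.trans hj'.2
  have h3 := Finset.card_le_card (Finset.union_subset (hsub b hb) (hsub c hc))
  rw [Finset.card_union_of_disjoint hdisj, Finset.card_sdiff_of_subset (Finset.subset_univ H),
    Finset.card_univ, Fintype.card_fin] at h3
  have key : ∀ a ∈ Finset.univ \ H.image f,
      (Finset.univ.filter fun j => f j = a).card ≤ (m + 2 - k) / 2 →
      mms v k ≤ (((m + 2 - k) / 2 : ℕ) : ℝ≥0) * w := by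
    intro a ha hcard
    refine (hf a).trans ((Finset.sum_le_card_nsmul _ _ w fun j hj =>
      hw j (Finset.mem_sdiff.1 (hsub a ha hj)).2).trans ?_)
    rw [nsmul_eq_mul]
    gcongr
  by_cases hle : (Finset.univ.filter fun j => f j = b).card ≤ (m + 2 - k) / 2
  · exact key b hb hle
  · exact key c hc (by omega)

theorem countP_sort_eq_card_filter (v : Valuation m) (q : ℝ≥0 → Prop) [DecidablePred q] :
    ((Finset.univ.val.map v).sort (· ≥ ·)).countP (fun a => decide (q a)) =
      (Finset.univ.filter fun j => q (v j)).card := by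
  rw [← Multiset.coe_countP, Multiset.sort_eq, Multiset.countP_map]
  rfl

theorem length_sort_map (v : Valuation m) :
    ((Finset.univ.val.map v).sort (· ≥ ·)).length = m := by
  simp

theorem le_card_filter_kthHighest_le (v : Valuation m) {l : ℕ} (hl : l ≤ m) :
    l ≤ (Finset.univ.filter fun j => kthHighest v l ≤ v j).card := by
  rcases Nat.eq_zero_or_pos l with rfl | hpos
  · exact Nat.zero_le _
  rw [← countP_sort_eq_card_filter v (kthHighest v l ≤ ·)]
  set L := (Finset.univ.val.map v).sort (· ≥ ·) with hL
  have hlen : L.length = m := length_sort_map v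
  have hsort : L.Pairwise (· ≥ ·) := Multiset.pairwise_sort _ _
  have hk : kthHighest v l = L[l - 1] := List.getD_eq_getElem _ _ (by rw [length_sort_map]; omega)
  have hall : ∀ a ∈ L.take l, kthHighest v l ≤ a := by
    intro a ha
    obtain ⟨t, ht, rfl⟩ := List.mem_iff_getElem.1 ha
    rw [List.getElem_take, hk]
    rw [List.length_take] at ht
    rcases (show t ≤ l - 1 by omega).eq_or_lt with h | h
    · simp [h]
    · exact List.pairwise_iff_getElem.1 hsort t (l - 1) (by omega) (by omega) h
  calc l = (L.take l).length := by rw [List.length_take]; omega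
    _ = (L.take l).countP (fun a => decide (kthHighest v l ≤ a)) :=
        (List.countP_eq_length.2 fun a ha => by simpa using hall a ha).symm
    _ ≤ _ := (List.take_sublist l L).countP_le

theorem card_filter_kthHighest_lt_lt (v : Valuation m) {l : ℕ} (hpos : 0 < l) (hl : l ≤ m) :
    (Finset.univ.filter fun j => kthHighest v l < v j).card < l := by
  rw [← countP_sort_eq_card_filter v (kthHighest v l < ·)]
  set L := (Finset.univ.val.map v).sort (· ≥ ·) with hL
  have hlen : L.length = m := length_sort_map v
  have hsort : L.Pairwise (· ≥ ·) := Multiset.pairwise_sort _ _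
  have hk : kthHighest v l = L[l - 1] := List.getD_eq_getElem _ _ (by rw [length_sort_map]; omega)
  have hdrop : (L.drop (l - 1)).countP (fun a => decide (kthHighest v l < a)) = 0 := by
    rw [List.countP_eq_zero]
    intro a ha
    obtain ⟨t, ht, rfl⟩ := List.mem_iff_getElem.1 ha
    rw [List.getElem_drop, hk]
    rw [List.length_drop] at ht
    simp only [decide_eq_true_eq, not_lt]
    rcases Nat.eq_zero_or_pos t with rfl | h
    · simp
    · exact List.pairwise_iff_getElem.1 hsort (l - 1) (l - 1 + t) (by omega) (by omega) (by omega)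
  have hsplit := List.take_append_drop (l - 1) L
  have htake := List.countP_le_length (l := L.take (l - 1))
    (p := fun a => decide (kthHighest v l < a))
  rw [List.length_take] at htake
  rw [← hsplit, List.countP_append, hdrop]
  omega

theorem kthHighest_of_lt (v : Valuation m) {l : ℕ} (hl : m < l) : kthHighest v l = 0 :=
  List.getD_eq_default _ _ (by rw [length_sort_map]; omega)

/-! ### Guarantees of the mechanism -/

theorem consistent_nAgentMechanism (n m : ℕ) : Consistent (nAgentMechanism n m) id 2 := by
  intro v i
  have hs := largeSpec_afterLarge v v
  have hn : 0 < n := i.pos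
  suffices h : mms (v i) n ≤ 2 * value (v i) (nAgentMechanism n m v v i) by
    have h' : (mms (v i) n : ℝ) ≤ 2 * value (v i) (nAgentMechanism n m v v i) := by
      exact_mod_cast h
    simp only [id]
    linarith
  by_cases hi : i ∈ (afterLarge v v).agents
  · have hN := nodup_agents_afterLarge v v
    rw [nAgentMechanism_of_mem v v hi, share_tentative v hN _ hi]
    set N := (afterLarge v v).agents with hNdef
    set M := (afterLarge v v).items with hMdef
    set μ := mms (v i) n with hμ
    have hsmall : ∀ x ∈ M, v i x ≤ μ / 2 := by
      intro x hx
      have h1 := not_le.1 (hs.not_isLarge i hi)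
      exact (Finset.le_sup hx).trans h1.le
    -- The tentative bundles partition `M`, and each is worth at most that of `i` plus one small
    -- item.
    have hupper : value (v i) M ≤ N.length * (value (v i) (tentative v N M i) + μ / 2) := by
      have h1 : value (v i) (pool (tentative v N M) N) =
          ∑ j ∈ N.toFinset, value (v i) (tentative v N M j) :=
        Finset.sum_biUnion fun j hj l hl hjl =>
          pairwiseDisjoint_tentative v hN M (by simpa using hj) (by simpa using hl) hjl
      rw [pool_tentative v hN (List.ne_nil_of_mem hi)] at h1
      rw [h1]
      refine (Finset.sum_le_card_nsmul _ _ _ fun j hj =>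
        value_tentative_le v hN hi (List.mem_toFinset.1 hj) hsmall).trans ?_
      rw [List.toFinset_card_of_nodup hN, nsmul_eq_mul]
    have hlower := sub_mul_mms_le_value (v i) hn M
    -- At most one item left with each served agent.
    have hcount : N.length ≤ n - (Finset.univ \ M).card := by
      have h1 := hs.card_add_length_le
      rw [List.length_finRange, ← hNdef, ← hMdef] at h1
      omega
    have hpos : (0 : ℝ≥0) < N.length := by
      exact_mod_cast List.length_pos_of_mem hi
    have hle : (N.length : ℝ≥0) * μ ≤
        N.length * (value (v i) (tentative v N M i) + μ / 2) := by
      refine le_trans ?_ (hlower.trans hupper)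
      gcongr
    have h2 : μ ≤ value (v i) (tentative v N M i) + μ / 2 := le_of_mul_le_mul_left hle hpos
    have h3 : (μ : ℝ) ≤ value (v i) (tentative v N M i) + μ / 2 := by exact_mod_cast h2
    have h4 : (μ : ℝ) ≤ 2 * value (v i) (tentative v N M i) := by linarith
    exact_mod_cast h4
  · obtain ⟨R, -, -, hlarge, hR⟩ := hs.alloc_eq_favorite i (List.mem_finRange i) hi
    rw [nAgentMechanism_of_notMem v v hi, hR]
    have h1 : mms (v i) n / 2 ≤ value (v i) (favorite (v i) R) :=
      hlarge.trans (sup_le_value_favorite _ _)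
    have h2 : (mms (v i) n : ℝ) / 2 ≤ value (v i) (favorite (v i) R) := by exact_mod_cast h1
    have h3 : (mms (v i) n : ℝ) ≤ 2 * value (v i) (favorite (v i) R) := by linarith
    exact_mod_cast h3

theorem exists_kthHighest_le_of_mem_nAgentMechanism (v p : Profile n m) (i : Fin n) {l : ℕ}
    (hl : n + (n + 1) / 2 ≤ l + 1) (hlm : l ≤ m) :
    ∃ j ∈ nAgentMechanism n m v p i, kthHighest (v i) l ≤ v i j := by
  have hcard := le_card_filter_kthHighest_le (v i) hlm
  obtain ⟨j, hj, hjK⟩ := exists_mem_nAgentMechanism_inter v p i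
    (K := Finset.univ.filter fun j => kthHighest (v i) l ≤ v i j)
    (fun x hx y hxy => by
      rw [Finset.mem_filter] at hx ⊢
      exact ⟨Finset.mem_univ y, hx.2.trans hxy⟩) (by omega)
  exact ⟨j, hj, (Finset.mem_filter.1 hjK).2⟩

/-- The guarantee for single items already holds at index `k - 1`. That spare index leaves two
bundles, rather than one, free of the better items. -/
theorem mms_le_mul_value_nAgentMechanism (v p : Profile n m) (i : Fin n) {k : ℕ} (hn : 2 ≤ n)
    (hk : k = n + (n + 1) / 2) (hkm : k + 3 ≤ m) :
    mms (v i) k ≤ ((m - k - 1 : ℕ) : ℝ≥0) * value (v i) (nAgentMechanism n m v p i) := by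
  obtain ⟨j, hj, hjv⟩ := exists_kthHighest_le_of_mem_nAgentMechanism v p i (l := k - 1)
    (by omega) (by omega)
  have hlt := card_filter_kthHighest_lt_lt (v i) (l := k - 1) (by omega) (by omega)
  -- Fewer than `k - 1` items exceed the `(k-1)`-th value; `H` pads them to exactly `k - 2`.
  obtain ⟨H, hsub, hH⟩ := Finset.exists_superset_card_eq
    (s := Finset.univ.filter fun j => kthHighest (v i) (k - 1) < v i j) (n := k - 2) (by omega)
    (by rw [Fintype.card_fin]; omega)
  have hw : ∀ j ∉ H, v i j ≤ kthHighest (v i) (k - 1) := by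
    intro x hx
    by_contra h
    exact hx (hsub (Finset.mem_filter.2 ⟨Finset.mem_univ x, not_le.1 h⟩))
  refine (mms_le_mul_of_card_add_two (v i) (by omega) hw).trans ?_
  refine mul_le_mul' ?_ (hjv.trans (le_value_of_mem _ hj))
  -- This needs `k + 3 ≤ m`: for `m = k + 2` it would read `2 ≤ 1`.
  exact_mod_cast (by omega : (m + 2 - k) / 2 ≤ m - k - 1)

theorem ceil_three_mul_div_two (n : ℕ) : ⌈(3 * n : ℚ) / 2⌉₊ = n + (n + 1) / 2 := by
  apply le_antisymm
  · rw [Nat.ceil_le, div_le_iff₀ (by norm_num)]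
    exact_mod_cast (by omega : 3 * n ≤ (n + (n + 1) / 2) * 2)
  · have h := Nat.le_ceil ((3 * n : ℚ) / 2)
    rw [div_le_iff₀ (by norm_num)] at h
    have h' : 3 * n ≤ ⌈(3 * n : ℚ) / 2⌉₊ * 2 := by exact_mod_cast h
    omega

end PlantSteal

open PlantSteal in
theorem mainTheorem7 (n m k : ℕ) (hn : 2 ≤ n) (hk : k = ⌈(3 * n : ℚ) / 2⌉₊)
    (α : ℝ) (hα : α = (m : ℝ) - k - 1) :
    -- the output is an allocation, and a partition if an agent remains for the later phases
    (∀ r p : Profile n m,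
      (∀ i i' : Fin n, i ≠ i' →
        Disjoint (nAgentMechanism n m r p i) (nAgentMechanism n m r p i')) ∧
      ((afterLarge r p).agents ≠ [] → ∀ j : Fin m, ∃ i, j ∈ nAgentMechanism n m r p i)) ∧
    Truthful (nAgentMechanism n m) ∧
    Consistent (nAgentMechanism n m) id 2 ∧
    (1 < α → Robust (nAgentMechanism n m) α k) ∧
    -- each agent gets value at least that of its `k`-th best item, and in fact such an item
    (∀ (v p : Profile n m) (i : Fin n),
      kthHighest (v i) k ≤ value (v i) (nAgentMechanism n m v p i) ∧
      (k ≤ m → ∃ j ∈ nAgentMechanism n m v p i, kthHighest (v i) k ≤ v i j)) := by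
  rw [ceil_three_mul_div_two] at hk
  refine ⟨fun r p => ⟨fun i i' hii' => disjoint_nAgentMechanism r p hii',
    exists_mem_nAgentMechanism r p⟩, truthful_nAgentMechanism n m,
    consistent_nAgentMechanism n m, fun hα1 v p i => ?_, fun v p i => ?_⟩
  -- `1 < α` says `k + 2 < m`, and integrality gains one more.
  · have hkm : k + 3 ≤ m := by
      have h : ((k + 2 : ℕ) : ℝ) < m := by
        push_cast
        linarith
      have := Nat.cast_lt.1 h
      omega
    have hle := mms_le_mul_value_nAgentMechanism v p i hn hk hkm
    have hcast : ((m - k - 1 : ℕ) : ℝ) = α := by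
      rw [Nat.cast_sub (by omega), Nat.cast_sub (by omega), hα, Nat.cast_one]
    have hle' : (mms (v i) k : ℝ) ≤ ((m - k - 1 : ℕ) : ℝ) *
        value (v i) (nAgentMechanism n m v p i) := by exact_mod_cast hle
    rw [hcast, mul_comm] at hle'
    exact (div_le_iff₀ (by linarith)).2 hle'
  · have hitem : k ≤ m → ∃ j ∈ nAgentMechanism n m v p i, kthHighest (v i) k ≤ v i j :=
      exists_kthHighest_le_of_mem_nAgentMechanism v p i (by omega)
    refine ⟨?_, hitem⟩
    rcases le_or_gt k m with h | h
    · obtain ⟨j, hj, hjv⟩ := hitem h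
      exact hjv.trans (le_value_of_mem _ hj)
    · rw [kthHighest_of_lt _ h]
      exact zero_le
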